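/- Let $G$ be a countably infinite amenable discrete group acting continuously, minimally and freely on an infinite compact metric space $X$. Let $M_G(X)$ be the convex set of $G$-invariant Borel probability measures on $X$, and let $E_G(X)$ be the set of its extreme points (the ergodic measures), with the weak* topology. Suppose that $E_G(X)$ is compact and has covering dimension $m\in\{0,1,2,\dots\}$. For $F\subset X$ closed and $O\subset X$ open, write $F\prec O$ if there are a finite collection $\mathcal U$ of open subsets of $X$ covering $F$ and elements $s_U\in G$ ($U\in\mathcal U$) such that the sets $s_UU$ are pairwise disjoint subsets of $O$. Suppose that the action has dynamical comparison: $F\prec O$ whenever $F$ is closed, $O$ is open and $\mu(F)<\mu(O)$ for all $\mu\in M_G(X)$. Then the action is $m$-almost finite. That is, for every integer $n\ge 1$, every finite set $K\subset G$ and every $\delta>0$ there are finitely many open sets $V_i\subset X$ and nonempty finite sets $S_i\subset G$ ($i\in I$) such that: (0) for every $i$, the sets $s\overline{V_i}$, $s\in S_i$, are pairwise disjoint (so $(S_i,\overline{V_i})$ is a tower); (i) every $S_i$ is $(K,\delta)$-invariant, i.e. $|\{s\in S_i: Ks\subset S_i\}|\ge(1-\delta)|S_i|$; (ii) $\operatorname{diam}(s\overline{V_i})<\delta$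 for all $i\in I$ and $s\in S_i$; (iii) the family $\{S_i\overline{V_i}: i\in I\}$ has chromatic number at most $m+1$, i.e. $I$ can be partitioned into $m+1$ (possibly empty) subsets such that $S_i\overline{V_i}\cap S_j\overline{V_j}=\emptyset$ whenever $i\ne j$ lie in the same subset; (iv) there are sets $S_i'\subset S_i$ with $|S_i'|\le|S_i|/n$ and $X\setminus\bigcup_{i\in I}S_iV_i\prec\bigcup_{i\in I}S_i'V_i$. -/

import Mathlib

open MeasureTheory Set
open scoped Pointwise ENNReal

namespace TopDyn

section Dimension

/-- Every finite open cover of `Y` has a finite open refinement covering `Y` such that each point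
lies in at most `k + 1` of its members. -/
def HasCoveringDimLE (Y : Type*) [TopologicalSpace Y] (k : ℕ) : Prop :=
  ∀ 𝒰 : Set (Set Y), 𝒰.Finite → (∀ U ∈ 𝒰, IsOpen U) → ⋃₀ 𝒰 = univ →
    ∃ 𝒱 : Set (Set Y), 𝒱.Finite ∧ (∀ V ∈ 𝒱, IsOpen V) ∧ ⋃₀ 𝒱 = univ ∧
      (∀ V ∈ 𝒱, ∃ U ∈ 𝒰, V ⊆ U) ∧
      ∀ y : Y, {V ∈ 𝒱 | y ∈ V}.ncard ≤ k + 1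

open Classical in
/-- The Lebesgue covering dimension: `⊥` (that is, `-1`) for the empty space, and `⊤` (infinite) if
no bound holds. -/
noncomputable def coveringDim (Y : Type*) [TopologicalSpace Y] : WithBot ℕ∞ :=
  if IsEmpty Y then ⊥ else ⨅ (k : ℕ) (_ : HasCoveringDimLE Y k), ((k : ℕ∞) : WithBot ℕ∞)

end Dimension

section Groups

variable {G : Type*} [Group G]

/-- A nonempty finite set `S` is `(K, δ)`-invariant if `|{s ∈ S : K s ⊆ S}| ≥ (1 - δ) |S|`. -/
def IsFolnerInvariant (K : Finset G) (δ : ℝ) (S : Finset G) : Prop :=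
  S.Nonempty ∧ (1 - δ) * (S.card : ℝ) ≤ ({s : G | s ∈ S ∧ ∀ t ∈ K, t * s ∈ S}.ncard : ℝ)

variable (G) in
/-- Amenability of a discrete group, as the Følner condition. -/
def IsAmenable : Prop :=
  ∀ (K : Finset G) (δ : ℝ), 0 < δ → ∃ S : Finset G, IsFolnerInvariant K δ S

end Groups

section Actions

variable (G : Type*) [Group G] (X : Type*) [MulAction G X]

/-- Every non-identity group element acts without fixed points. -/
def IsFreeAction : Prop :=
  ∀ (g : G) (x : X), g • x = x → g = 1

/-- `M_G(X)`: the `G`-invariant Borel probability measures on `X`. On a compact metric space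
all of them are regular. -/
def invariantMeasures [MeasurableSpace X] : Set (ProbabilityMeasure X) :=
  {μ | SMulInvariantMeasure G X (μ : Measure X)}

/-- `E_G(X)`: the extreme points of the convex set `M_G(X)`. As a set of probability measures it
carries the weak* topology, i.e. Mathlib's topology of `ProbabilityMeasure X`. -/
def extremeInvariantMeasures [MeasurableSpace X] : Set (ProbabilityMeasure X) :=
  {μ | (μ : Measure X) ∈
    extremePoints ℝ≥0∞ ((fun ν : ProbabilityMeasure X => (ν : Measure X)) '' invariantMeasures G X)}

variable {G X}

/-- `F ≺_m O`: there are a finite collection `𝒰` of open sets covering `F`, group elements `s U`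
and a colouring `c` of `𝒰` in `m + 1` colours, such that the translates `s U • U` are subsets of
`O` and translates of distinct members of the same colour are disjoint. -/
def Subequiv (G : Type*) [Group G] {X : Type*} [MulAction G X] [TopologicalSpace X]
    (m : ℕ) (F O : Set X) : Prop :=
  ∃ (𝒰 : Set (Set X)) (s : Set X → G) (c : Set X → Fin (m + 1)),
    𝒰.Finite ∧ (∀ U ∈ 𝒰, IsOpen U) ∧ F ⊆ ⋃₀ 𝒰 ∧ (∀ U ∈ 𝒰, s U • U ⊆ O) ∧
    ∀ U ∈ 𝒰, ∀ U' ∈ 𝒰, U ≠ U' → c U = c U' → Disjoint (s U • U) (s U' • U')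

/-- Dynamical `m`-comparison. -/
def HasDynamicalComparison (G : Type*) [Group G] (X : Type*) [MulAction G X] [TopologicalSpace X]
    [MeasurableSpace X] (m : ℕ) : Prop :=
  ∀ F O : Set X, IsClosed F → IsOpen O →
    (∀ μ ∈ invariantMeasures G X, (μ : Measure X) F < (μ : Measure X) O) → Subequiv G m F O

/-- `(S, V)` is a tower: the levels `s • V`, `s ∈ S`, are pairwise disjoint. -/
def IsTower (S : Finset G) (V : Set X) : Prop :=
  (S : Set G).PairwiseDisjoint fun s => s • V

/-- The family `A` has chromatic number at most `d`: it can be split into `d` subfamilies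
(some of them possibly empty), each of which consists of pairwise disjoint sets. -/
def ChromaticNumberLE {ι : Type*} (A : ι → Set X) (d : ℕ) : Prop :=
  ∃ c : ι → Fin d, ∀ i j, i ≠ j → c i = c j → Disjoint (A i) (A j)

/-- `m`-almost finiteness of an action on a metric space. Below `(S i : Set G) • V i` is the union
of the levels of the tower `(S i, V i)`. -/
def IsAlmostFinite (G : Type*) [Group G] (X : Type*) [MulAction G X] [MetricSpace X]
    (m : ℕ) : Prop :=
  ∀ (n : ℕ) (K : Finset G) (δ : ℝ), 0 < n → 0 < δ →
    ∃ (N : ℕ) (S : Fin N → Finset G) (V : Fin N → Set X),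
      (∀ i, IsTower (S i) (closure (V i))) ∧
      (∀ i, IsOpen (V i)) ∧
      (∀ i, IsFolnerInvariant K δ (S i)) ∧
      (∀ i, ∀ s ∈ S i, Metric.diam (s • closure (V i)) < δ) ∧
      ChromaticNumberLE (fun i => (S i : Set G) • closure (V i)) (m + 1) ∧
      ∃ S' : Fin N → Finset G,
        (∀ i, S' i ⊆ S i) ∧ (∀ i, ((S' i).card : ℝ) ≤ ((S i).card : ℝ) / n) ∧
        Subequiv G 0 (univ \ ⋃ i, (S i : Set G) • V i) (⋃ i, (S' i : Set G) • V i)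

end Actions

end TopDyn

set_option linter.unusedSectionVars false

/-! For one invariant measure, amenability and freeness give Ornstein–Weiss towers: disjoint open
towers with Følner shapes whose union has almost full measure (`exists_openCastle`). The complement
of such a castle is closed, so its measure is upper semicontinuous and the castle also serves all
nearby measures. By compactness, finitely many castles serve all ergodic measures. The remaining
difficulty is that different castles overlap in `X`.

The dimension of the space `E` of ergodic measures controls the overlap. `E` has a finite closed
cover, subordinate to the castles' neighbourhoods, in `m + 1` colours with disjoint members within
each colour (`exists_colored_closed_cover`). Disjoint closed sets of ergodic measures are almost
carried by open subsets of `X` with disjoint closures (`exists_separating_open_sets`). The reason is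
the mean ergodic theorem: by compactness of `E`, orbit averages of `f` are `L²`-close to the
constant `∫ f dν` uniformly in `ν ∈ E`. Consequently the functions `ν ↦ ∫ f dν` have a uniform
closure that is an algebra, which is all of `C(E)` by Stone–Weierstrass. So some `f` has integral
near `j` on the `j`-th closed set, and the sets where an orbit average of `f` is near `j` separate.
Cutting each castle down to its separating set makes castles of one colour disjoint.

The uncovered closed set is then small for every ergodic measure, hence for every invariant measure
by Krein–Milman. Keeping about `1/n` of each shape retains a measure of order `1/(n(m+1))`, which
exceeds that of the uncovered set, and comparison finishes the proof. -/

namespace TopDyn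

/-! ### Følner sets. -/

section Folner

variable {G : Type*} [Group G]

open Classical in
theorem IsFolnerInvariant.card_le {K S : Finset G} {δ : ℝ} (h : IsFolnerInvariant K δ S) :
    (1 - δ) * (S.card : ℝ) ≤ ((S.filter fun s => ∀ t ∈ K, t * s ∈ S).card : ℝ) := by
  have h2 := h.2
  have : {s : G | s ∈ S ∧ ∀ t ∈ K, t * s ∈ S} =
      ((S.filter fun s => ∀ t ∈ K, t * s ∈ S : Finset G) : Set G) := by
    ext s; simp
  rwa [this, Set.ncard_coe_finset] at h2

open Classical in
theorem isFolnerInvariant_of_card_le {K S : Finset G} {δ : ℝ} (hS : S.Nonempty)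
    (h : (1 - δ) * (S.card : ℝ) ≤ ((S.filter fun s => ∀ t ∈ K, t * s ∈ S).card : ℝ)) :
    IsFolnerInvariant K δ S := by
  refine ⟨hS, ?_⟩
  have : {s : G | s ∈ S ∧ ∀ t ∈ K, t * s ∈ S} =
      ((S.filter fun s => ∀ t ∈ K, t * s ∈ S : Finset G) : Set G) := by
    ext s; simp
  rwa [this, Set.ncard_coe_finset]

theorem IsFolnerInvariant.mono {K K' S : Finset G} {δ δ' : ℝ} (h : IsFolnerInvariant K' δ' S)
    (hK : K ⊆ K') (hδ : δ' ≤ δ) : IsFolnerInvariant K δ S := by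
  classical
  refine isFolnerInvariant_of_card_le h.1 ?_
  have h1 := h.card_le
  have h2 : (S.filter fun s => ∀ t ∈ K', t * s ∈ S).card ≤
      (S.filter fun s => ∀ t ∈ K, t * s ∈ S).card := by
    refine Finset.card_le_card fun s hs => ?_
    simp only [Finset.mem_filter] at hs ⊢
    exact ⟨hs.1, fun t ht => hs.2 t (hK ht)⟩
  have h3 : ((S.filter fun s => ∀ t ∈ K', t * s ∈ S).card : ℝ) ≤
      (S.filter fun s => ∀ t ∈ K, t * s ∈ S).card := by exact_mod_cast h2
  nlinarith [(Nat.cast_nonneg S.card : (0 : ℝ) ≤ S.card)]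

open Classical in
/-- Few elements of a Følner set are moved out of it by a given element of `K`. -/
theorem IsFolnerInvariant.card_filter_notMem_le {K S : Finset G} {δ : ℝ}
    (h : IsFolnerInvariant K δ S) {t : G} (ht : t ∈ K) :
    ((S.filter fun s => t * s ∉ S).card : ℝ) ≤ δ * S.card := by
  have h1 := h.card_le
  have h2 : (S.filter fun s => ∀ t ∈ K, t * s ∈ S).card + (S.filter fun s => t * s ∉ S).card
      ≤ S.card := by
    rw [← Finset.card_union_of_disjoint]
    · exact Finset.card_le_card (Finset.union_subset (Finset.filter_subset _ _)
        (Finset.filter_subset _ _))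
    · rw [Finset.disjoint_left]
      intro s hs hs'
      simp only [Finset.mem_filter] at hs hs'
      exact hs'.2 (hs.2 t ht)
  have h3 : ((S.filter fun s => ∀ t ∈ K, t * s ∈ S).card : ℝ) +
    (S.filter fun s => t * s ∉ S).card ≤ S.card := by exact_mod_cast h2
  linarith

/-- Some `s ∈ S` has `K s ⊆ S`, and right translation by `s` is injective. This forces shapes to be
large. -/
theorem IsFolnerInvariant.card_le_card {K S : Finset G} {δ : ℝ} (h : IsFolnerInvariant K δ S)
    (hδ : δ < 1) : K.card ≤ S.card := by
  classical
  have h1 := h.card_le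
  have hpos : (0 : ℝ) < S.card := by exact_mod_cast h.1.card_pos
  have h2 : (0 : ℝ) < (S.filter fun s => ∀ t ∈ K, t * s ∈ S).card :=
    lt_of_lt_of_le (mul_pos (by linarith) hpos) h1
  obtain ⟨s, hs⟩ := Finset.card_pos.1 (by exact_mod_cast h2)
  simp only [Finset.mem_filter] at hs
  exact Finset.card_le_card_of_injOn (fun t => t * s) (fun t ht => hs.2 t ht)
    (fun a _ b _ hab => mul_right_cancel hab)

/-- A large subset of a Følner set is a Følner set. -/
theorem IsFolnerInvariant.of_subset {K F S : Finset G} {δ ε : ℝ}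
    (h : IsFolnerInvariant K (δ / 2) F) (hS : S ⊆ F) (hcard : (1 - ε) * (F.card : ℝ) ≤ S.card)
    (hε : ε * (K.card + 1) ≤ δ / 2) (hε1 : ε < 1) (hδ : δ ≤ 1) : IsFolnerInvariant K δ S := by
  classical
  have hF : (0 : ℝ) < F.card := by exact_mod_cast h.1.card_pos
  have hSpos : (0 : ℝ) < S.card := lt_of_lt_of_le (mul_pos (by linarith) hF) hcard
  refine isFolnerInvariant_of_card_le (Finset.card_pos.1 (by exact_mod_cast hSpos)) ?_
  have h1 := h.card_le
  have hSF : (S.card : ℝ) ≤ F.card := by exact_mod_cast Finset.card_le_card hS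
  -- A point of the `K`-core of `F` fails to be in the `K`-core of `S` only if it lies in `F \ S` or
  -- in `t⁻¹(F \ S)` for some `t ∈ K`; hence the factor `K.card + 1`.
  have hsub : (F.filter fun s => ∀ t ∈ K, t * s ∈ F) ⊆
      (S.filter fun s => ∀ t ∈ K, t * s ∈ S) ∪
        ((F \ S) ∪ K.biUnion fun t => (F \ S).image fun u => t⁻¹ * u) := by
    intro s hs
    simp only [Finset.mem_filter] at hs
    simp only [Finset.mem_union, Finset.mem_filter, Finset.mem_sdiff, Finset.mem_biUnion,
      Finset.mem_image]
    by_cases h1 : s ∈ S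
    · by_cases h2 : ∀ t ∈ K, t * s ∈ S
      · exact Or.inl ⟨h1, h2⟩
      · push Not at h2
        obtain ⟨t, ht, hts⟩ := h2
        exact Or.inr (Or.inr ⟨t, ht, t * s, ⟨hs.2 t ht, hts⟩, by group⟩)
    · exact Or.inr (Or.inl ⟨hs.1, h1⟩)
  have hc1 := Finset.card_le_card hsub
  have hc2 := (hc1.trans (Finset.card_union_le _ _)).trans
    (Nat.add_le_add_left (Finset.card_union_le _ _) _)
  have hc3 : (K.biUnion fun t => (F \ S).image fun u => t⁻¹ * u).card ≤ K.card * (F \ S).card :=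
    Finset.card_biUnion_le_card_mul _ _ _ fun t _ => Finset.card_image_le
  have hc4 : ((F.filter fun s => ∀ t ∈ K, t * s ∈ F).card : ℝ) ≤
      (S.filter fun s => ∀ t ∈ K, t * s ∈ S).card + ((F \ S).card + K.card * (F \ S).card) := by
    exact_mod_cast hc2.trans (by gcongr)
  have hd : ((F \ S).card : ℝ) = F.card - S.card := by
    rw [Finset.card_sdiff_of_subset hS, Nat.cast_sub (Finset.card_le_card hS)]
  have hd' : ((F \ S).card : ℝ) ≤ ε * F.card := by rw [hd]; linarith
  have hK : (0 : ℝ) ≤ K.card := Nat.cast_nonneg _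
  have e1 : (K.card + 1) * ((F \ S).card : ℝ) ≤ (K.card + 1) * (ε * F.card) := by gcongr
  have e2 : (ε * (K.card + 1)) * (F.card : ℝ) ≤ δ / 2 * F.card := by gcongr
  have e3 : (1 - δ) * (S.card : ℝ) ≤ (1 - δ) * F.card :=
    mul_le_mul_of_nonneg_left hSF (by linarith)
  nlinarith

end Folner

/-! ### Greedy construction of measurable quasi-tilings. -/

section QuasiTiling

variable (G : Type*) [Group G] (X : Type*) [MetricSpace X] [MeasurableSpace X] [MulAction G X]

/-- A finite family of pairwise disjoint towers `(S i, V i)` with measurable bases and levels of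
diameter at most `ρ`, whose shapes `S i` fill large parts of `(K, δ)`-invariant sets `F i`, and
whose union absorbs the sets `F i • V i`. -/
structure QuasiTiling (K : Finset G) (δ ε ρ : ℝ) where
  ι : Type
  fin : Finite ι
  F : ι → Finset G
  S : ι → Finset G
  V : ι → Set X
  invariant : ∀ i, IsFolnerInvariant K δ (F i)
  subset : ∀ i, S i ⊆ F i
  card_le : ∀ i, (1 - ε) * ((F i).card : ℝ) ≤ (S i).card
  measurableSet : ∀ i, MeasurableSet (V i)
  disjoint : ∀ i j, ∀ s ∈ S i, ∀ t ∈ S j, (i, s) ≠ (j, t) → Disjoint (s • V i) (t • V j)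
  diam_le : ∀ i, ∀ s ∈ S i, Metric.diam (s • V i) ≤ ρ
  absorb : ∀ i, ∀ s ∈ F i, s • V i ⊆ ⋃ j, ⋃ t ∈ S j, t • V j

namespace QuasiTiling

variable {G X} {K : Finset G} {δ ε ρ : ℝ}

/-- The set covered by the towers. -/
def carrier (Q : QuasiTiling G X K δ ε ρ) : Set X := ⋃ j, ⋃ t ∈ Q.S j, t • Q.V j

def empty : QuasiTiling G X K δ ε ρ where
  ι := PEmpty
  fin := inferInstance
  F := PEmpty.elim
  S := PEmpty.elim
  V := PEmpty.elim
  invariant i := i.elim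
  subset i := i.elim
  card_le i := i.elim
  measurableSet i := i.elim
  disjoint i := i.elim
  diam_le i := i.elim
  absorb i := i.elim

def mono {K' : Finset G} {δ' : ℝ} (Q : QuasiTiling G X K' δ' ε ρ) (hK : K ⊆ K') (hδ : δ' ≤ δ) :
    QuasiTiling G X K δ ε ρ where
  ι := Q.ι
  fin := Q.fin
  F := Q.F
  S := Q.S
  V := Q.V
  invariant i := (Q.invariant i).mono hK hδ
  subset := Q.subset
  card_le := Q.card_le
  measurableSet := Q.measurableSet
  disjoint := Q.disjoint
  diam_le := Q.diam_le
  absorb := Q.absorb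

section Greedy

variable [MeasurableConstSMul G X]

theorem measurableSet_carrier (Q : QuasiTiling G X K δ ε ρ) : MeasurableSet Q.carrier := by
  have := Q.fin
  exact .iUnion fun i => Finset.measurableSet_biUnion _ fun t _ => (Q.measurableSet i).const_smul t

open Classical in
/-- Translates of a small set `P` by large parts of `F` can be added to a quasi-tiling. -/
theorem exists_extension_piece (Q : QuasiTiling G X K δ ε ρ) {F : Finset G}
    (hF : IsFolnerInvariant K δ F) {P : Set X} (hP : MeasurableSet P)
    (hdisj : ∀ f ∈ F, ∀ f' ∈ F, f ≠ f' → Disjoint (f • P) (f' • P))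
    (hdiam : ∀ f ∈ F, ∀ V ⊆ P, Metric.diam (f • V) ≤ ρ) (hε : ε ≤ 1) :
    ∃ Q' : QuasiTiling G X K δ ε ρ, Q.carrier ⊆ Q'.carrier ∧
      ∀ x ∈ P, ε * (F.card : ℝ) ≤ (F.filter fun f => f • x ∈ Q'.carrier).card := by
  set A := Q.carrier with hA
  have hAm : MeasurableSet A := Q.measurableSet_carrier
  -- `P` is partitioned by the set `T x` of translates of `x` not yet covered. A class whose `T x`
  -- has at least `(1 - ε)|F|` elements becomes the base of a new tower with that shape. For the
  -- other points more than `ε|F|` translates are covered already.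
  let T : X → Finset G := fun x => F.filter fun f => f • x ∉ A
  let J : Type _ := {S : Finset G // S ⊆ F ∧ (1 - ε) * (F.card : ℝ) ≤ S.card}
  have hJfin : Finite J := by
    refine Set.Finite.to_subtype (s := {S : Finset G | S ⊆ F ∧ (1 - ε) * (F.card : ℝ) ≤ S.card}) ?_
    exact (F.powerset.finite_toSet).subset fun S hS => by simpa using hS.1
  -- `J` lives in the universe of `G`, whereas a quasi-tiling is indexed by a `Type`.
  obtain ⟨N, ⟨e⟩⟩ := Finite.exists_equiv_fin J
  let W : J → Set X := fun S => {x | x ∈ P ∧ T x = S.1}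
  have hWm : ∀ S, MeasurableSet (W S) := by
    intro S
    have : W S = P ∩ ⋂ f ∈ F, {x | (f • x ∉ A) ↔ f ∈ S.1} := by
      ext x
      simp only [W, T, mem_ofPred_eq, mem_inter_iff, mem_iInter, and_congr_right_iff]
      intro _
      constructor
      · intro h f hf
        rw [← h]; simp [hf]
      · intro h
        ext f
        simp only [Finset.mem_filter]
        exact ⟨fun ⟨h1, h2⟩ => (h f h1).1 h2, fun h1 => ⟨S.2.1 h1, (h f (S.2.1 h1)).2 h1⟩⟩
    rw [this]
    refine hP.inter (Finset.measurableSet_biInter _ fun f _ => ?_)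
    have hm : MeasurableSet {x : X | f • x ∉ A} := (measurable_const_smul f) hAm.compl
    by_cases hf : f ∈ S.1
    · simpa [hf] using! hm
    · have : {x | f • x ∉ A ↔ f ∈ S.1} = (fun x : X => f • x) ⁻¹' A := by ext x; simp [hf]
      rw [this]
      exact (measurable_const_smul f) hAm
  have hWA : ∀ S : J, ∀ s ∈ S.1, Disjoint (s • W S) A := by
    intro S s hs
    rw [Set.disjoint_left]
    rintro _ ⟨x, hx, rfl⟩
    have : s ∈ T x := hx.2 ▸ hs
    exact (Finset.mem_filter.1 this).2
  have hcov : ∀ S : J, ∀ f ∈ F, f • W S ⊆ A ∪ ⋃ S : J, ⋃ t ∈ S.1, t • W S := by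
    rintro S f hf _ ⟨x, hx, rfl⟩
    by_cases h : f • x ∈ A
    · exact Or.inl h
    · refine Or.inr (mem_iUnion.2 ⟨S, mem_iUnion₂.2 ⟨f, ?_, x, hx, rfl⟩⟩)
      rw [← hx.2]
      exact Finset.mem_filter.2 ⟨hf, h⟩
  have hunion : (⋃ j : Q.ι ⊕ Fin N, ⋃ t ∈ Sum.elim Q.S (fun k => (e.symm k).1) j,
      t • Sum.elim Q.V (fun k => W (e.symm k)) j) = A ∪ ⋃ S : J, ⋃ t ∈ S.1, t • W S := by
    rw [iUnion_sum]
    simp only [Sum.elim_inl, Sum.elim_inr]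
    congr 1
    exact e.symm.surjective.iUnion_comp fun S : J => ⋃ t ∈ S.1, t • W S
  have hfin := Q.fin
  let Q' : QuasiTiling G X K δ ε ρ :=
    { ι := Q.ι ⊕ Fin N
      fin := inferInstance
      F := Sum.elim Q.F fun _ => F
      S := Sum.elim Q.S fun k => (e.symm k).1
      V := Sum.elim Q.V fun k => W (e.symm k)
      invariant := by rintro (i | k) <;> simp [Q.invariant, hF]
      subset := by
        rintro (i | k)
        · exact Q.subset i
        · exact (e.symm k).2.1
      card_le := by
        rintro (i | k)
        · exact Q.card_le i
        · exact (e.symm k).2.2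
      measurableSet := by rintro (i | k) <;> simp [Q.measurableSet, hWm]
      disjoint := by
        rintro (i | k) (j | l) s hs t ht hne
        · exact Q.disjoint i j s hs t ht (by simpa using hne)
        · refine (hWA _ t ht).symm.mono_left ?_
          exact subset_iUnion_of_subset i (subset_iUnion₂_of_subset s hs le_rfl)
        · refine (hWA _ s hs).mono_right ?_
          exact subset_iUnion_of_subset j (subset_iUnion₂_of_subset t ht le_rfl)
        · simp only [Sum.elim_inr] at hs ht ⊢
          by_cases hst : s = t
          · subst hst
            have hkl : k ≠ l := by rintro rfl; exact hne rfl
            rw [Set.disjoint_left]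
            rintro _ ⟨x, hx, rfl⟩ ⟨y, hy, hxy⟩
            have hxy' : y = x := MulAction.injective s hxy
            subst hxy'
            exact hkl (e.symm.injective (Subtype.ext (hx.2.symm.trans hy.2)))
          · refine (hdisj s ((e.symm k).2.1 hs) t ((e.symm l).2.1 ht) hst).mono ?_ ?_
            · exact Set.smul_set_mono fun x hx => hx.1
            · exact Set.smul_set_mono fun x hx => hx.1
      diam_le := by
        rintro (i | k) s hs
        · exact Q.diam_le i s hs
        · exact hdiam s ((e.symm k).2.1 hs) _ fun x hx => hx.1
      absorb := by
        rw [hunion]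
        rintro (i | k) s hs
        · exact (Q.absorb i s hs).trans subset_union_left
        · exact hcov _ s hs }
  have hQ' : Q'.carrier = A ∪ ⋃ S : J, ⋃ t ∈ S.1, t • W S := hunion
  refine ⟨Q', hQ' ▸ subset_union_left, fun x hx => ?_⟩
  by_cases hT : (1 - ε) * (F.card : ℝ) ≤ (T x).card
  · have hall : (F.filter fun f => f • x ∈ Q'.carrier) = F := by
      refine Finset.filter_true_of_mem fun f hf => ?_
      rw [hQ']
      exact hcov ⟨T x, Finset.filter_subset _ _, hT⟩ f hf ⟨x, ⟨hx, rfl⟩, rfl⟩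
    rw [hall]
    exact mul_le_of_le_one_left (Nat.cast_nonneg _) hε
  · have h1 : (F.filter fun f => f • x ∈ A).card + (T x).card = F.card :=
      Finset.card_filter_add_card_filter_not _
    have h2 : (F.filter fun f => f • x ∈ A).card ≤
        (F.filter fun f => f • x ∈ Q'.carrier).card :=
      Finset.card_le_card (Finset.monotone_filter_right _ fun f _ h => hQ' ▸ Or.inl h)
    have h1' : ((F.filter fun f => f • x ∈ A).card : ℝ) + (T x).card = F.card := by
      exact_mod_cast h1
    have h2' : ((F.filter fun f => f • x ∈ A).card : ℝ) ≤
        (F.filter fun f => f • x ∈ Q'.carrier).card := by exact_mod_cast h2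
    linarith

open Classical in
theorem exists_extension_of_finset (Q : QuasiTiling G X K δ ε ρ) {F : Finset G}
    (hF : IsFolnerInvariant K δ F) (hε : ε ≤ 1) (Ps : Finset (Set X))
    (hPs : ∀ P ∈ Ps, MeasurableSet P ∧
      (∀ f ∈ F, ∀ f' ∈ F, f ≠ f' → Disjoint (f • P) (f' • P)) ∧
      ∀ f ∈ F, ∀ V ⊆ P, Metric.diam (f • V) ≤ ρ) :
    ∃ Q' : QuasiTiling G X K δ ε ρ, Q.carrier ⊆ Q'.carrier ∧
      ∀ P ∈ Ps, ∀ x ∈ P, ε * (F.card : ℝ) ≤ (F.filter fun f => f • x ∈ Q'.carrier).card := by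
  induction Ps using Finset.induction_on with
  | empty => exact ⟨Q, le_rfl, by simp⟩
  | insert P Ps hP ih =>
    obtain ⟨Q₁, h1, h2⟩ := ih fun P' hP' => hPs P' (Finset.mem_insert_of_mem hP')
    obtain ⟨hm, hd, hdi⟩ := hPs P (Finset.mem_insert_self _ _)
    obtain ⟨Q₂, h3, h4⟩ := Q₁.exists_extension_piece hF hm hd hdi hε
    refine ⟨Q₂, h1.trans h3, fun P' hP' x hx => ?_⟩
    rcases Finset.mem_insert.1 hP' with rfl | hP'
    · exact h4 x hx
    · refine (h2 P' hP' x hx).trans ?_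
      exact_mod_cast Finset.card_le_card (Finset.monotone_filter_right _ fun f _ h => h3 h)

end Greedy

end QuasiTiling

end QuasiTiling

/-! ### Measure estimates for quasi-tilings. -/

section TilingMeasure

variable {G : Type*} [Group G] {X : Type*} [MeasurableSpace X] [MulAction G X]

theorem measureReal_iUnion_levels_le {ι : Type*} [Fintype ι] (μ : Measure X) [IsFiniteMeasure μ]
    [SMulInvariantMeasure G X μ] (S : ι → Finset G) (V : ι → Set X) :
    μ.real (⋃ j, ⋃ t ∈ S j, t • V j) ≤ ∑ j, ((S j).card : ℝ) * μ.real (V j) := by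
  refine (measureReal_iUnion_fintype_le _).trans (Finset.sum_le_sum fun j _ => ?_)
  refine (measureReal_biUnion_finset_le _ _).trans ?_
  simp [measureReal_def, measure_smul]

variable [MeasurableConstSMul G X]

theorem measureReal_iUnion_levels {ι : Type*} [Fintype ι] (μ : Measure X) [IsFiniteMeasure μ]
    [SMulInvariantMeasure G X μ] {S : ι → Finset G} {V : ι → Set X}
    (hV : ∀ i, MeasurableSet (V i))
    (hd : ∀ i j, ∀ s ∈ S i, ∀ t ∈ S j, (i, s) ≠ (j, t) → Disjoint (s • V i) (t • V j)) :
    μ.real (⋃ j, ⋃ t ∈ S j, t • V j) = ∑ j, ((S j).card : ℝ) * μ.real (V j) := by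
  classical
  have h : (⋃ j, ⋃ t ∈ S j, t • V j) =
      ⋃ p ∈ (Finset.univ.sigma S : Finset (Σ _ : ι, G)), p.2 • V p.1 := by
    ext x; simp
  rw [h, measureReal_biUnion_finset, Finset.sum_sigma]
  · simp [measureReal_def, measure_smul]
  · rintro ⟨i, s⟩ hi ⟨j, t⟩ hj hne
    refine hd i j s (by simpa using hi) t (by simpa using hj) ?_
    rintro ⟨rfl, rfl⟩
    exact hne rfl
  · exact fun p _ => (hV p.1).const_smul p.2

end TilingMeasure

namespace QuasiTiling

variable {G : Type*} [Group G] {X : Type*} [MetricSpace X] [MeasurableSpace X] [MulAction G X]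
  [MeasurableConstSMul G X] {K : Finset G} {δ ε ρ : ℝ}

/-- The carrier of a quasi-tiling is almost invariant under the elements of `K`. -/
theorem measureReal_smul_diff_carrier_le (Q : QuasiTiling G X K δ ε ρ) (μ : Measure X)
    [IsProbabilityMeasure μ] [SMulInvariantMeasure G X μ] (hε : ε ≤ 1 / 2) (hδ : 0 ≤ δ) {g : G}
    (hg : g ∈ K) : μ.real (g • Q.carrier \ Q.carrier) ≤ 2 * δ := by
  classical
  have := Q.fin
  have := Fintype.ofFinite Q.ι
  have hsub : g • Q.carrier \ Q.carrier ⊆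
      ⋃ i, ⋃ t ∈ ((Q.F i).filter fun s => g * s ∉ Q.F i).image (g * ·), t • Q.V i := by
    rintro _ ⟨⟨x, hx, rfl⟩, hxn⟩
    simp only [carrier, mem_iUnion] at hx
    obtain ⟨i, s, hs, v, hv, rfl⟩ := hx
    -- By `absorb`, a level can leave the carrier under `g` only if `g * s` leaves the full Følner
    -- set `F i`, not merely the shape `S i`.
    have hgs : g * s ∉ Q.F i := fun h =>
      hxn (Q.absorb i _ h ⟨v, hv, by simp [mul_smul]⟩)
    refine mem_iUnion.2 ⟨i, mem_iUnion₂.2 ⟨g * s, ?_, v, hv, by simp [mul_smul]⟩⟩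
    exact Finset.mem_image_of_mem _ (Finset.mem_filter.2 ⟨Q.subset i hs, hgs⟩)
  have htot : ∑ i, ((Q.S i).card : ℝ) * μ.real (Q.V i) ≤ 1 := by
    rw [← measureReal_iUnion_levels μ Q.measurableSet Q.disjoint]
    exact measureReal_le_one
  calc μ.real (g • Q.carrier \ Q.carrier)
      ≤ _ := measureReal_mono hsub
    _ ≤ _ := measureReal_iUnion_levels_le μ _ _
    _ ≤ ∑ i, (2 * δ) * (((Q.S i).card : ℝ) * μ.real (Q.V i)) := by
        refine Finset.sum_le_sum fun i _ => ?_
        rw [← mul_assoc]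
        refine mul_le_mul_of_nonneg_right ?_ measureReal_nonneg
        have h1 : ((((Q.F i).filter fun s => g * s ∉ Q.F i).image (g * ·)).card : ℝ) ≤
            ((Q.F i).filter fun s => g * s ∉ Q.F i).card := by exact_mod_cast Finset.card_image_le
        have h2 := (Q.invariant i).card_filter_notMem_le hg
        have h3 := Q.card_le i
        have h4 : ((Q.F i).card : ℝ) ≤ 2 * (Q.S i).card := by
          nlinarith [(Nat.cast_nonneg (Q.F i).card : (0 : ℝ) ≤ _)]
        calc _ ≤ δ * ((Q.F i).card : ℝ) := h1.trans h2
          _ ≤ δ * (2 * (Q.S i).card) := by gcongr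
          _ = _ := by ring
    _ ≤ 2 * δ := by
        rw [← Finset.mul_sum]
        exact mul_le_of_le_one_right (by linarith) htot

open Classical in
-- Double counting. Each point of the set `Z`, whose `F`-translates all miss the old carrier, has at
-- least `ε|F|` translates in the newly covered part. Integrating and using invariance, the new part
-- has measure at least `ε μ(Z)`. Almost invariance of the old carrier shows that `Z` contains its
-- complement up to measure `|F|η`.
theorem measureReal_compl_carrier_le (Q Q' : QuasiTiling G X K δ ε ρ) (μ : Measure X)
    [IsProbabilityMeasure μ] [SMulInvariantMeasure G X μ] (hε0 : 0 ≤ ε) {η : ℝ}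
    {F : Finset G} (hF : F.Nonempty) (hsub : Q.carrier ⊆ Q'.carrier)
    (hQ' : ∀ x, ε * (F.card : ℝ) ≤ (F.filter fun f => f • x ∈ Q'.carrier).card)
    (hη : ∀ f ∈ F, μ.real (f⁻¹ • Q.carrier \ Q.carrier) ≤ η) :
    μ.real Q'.carrierᶜ ≤ (1 - ε) * μ.real Q.carrierᶜ + ε * (F.card * η) := by
  set A := Q.carrier
  set B := Q'.carrier
  have hA : MeasurableSet A := Q.measurableSet_carrier
  have hB : MeasurableSet B := Q'.measurableSet_carrier
  have hFpos : (0 : ℝ) < F.card := by exact_mod_cast hF.card_pos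
  set Z : Set X := {x | ∀ f ∈ F, f • x ∉ A} with hZ
  have hZm : MeasurableSet Z := by
    have : Z = ⋂ f ∈ F, (fun x : X => f • x) ⁻¹' Aᶜ := by ext x; simp [hZ]
    rw [this]
    exact Finset.measurableSet_biInter _ fun f _ => measurable_const_smul f hA.compl
  have hEm : ∀ f : G, MeasurableSet ((fun x : X => f • x) ⁻¹' (B \ A)) := fun f =>
    measurable_const_smul f (hB.diff hA)
  have h1 : ε * F.card * μ.real Z ≤ F.card * μ.real (B \ A) := by
    have hint : ∀ f ∈ F, Integrable
        (((fun x : X => f • x) ⁻¹' (B \ A)).indicator fun _ => (1 : ℝ)) μ := fun f _ =>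
      (integrable_const _).indicator (hEm f)
    calc ε * F.card * μ.real Z = ∫ x, Z.indicator (fun _ => ε * F.card) x ∂μ := by
          rw [integral_indicator_const _ hZm, smul_eq_mul, mul_comm]
      _ ≤ ∫ x, ∑ f ∈ F, ((fun x : X => f • x) ⁻¹' (B \ A)).indicator (fun _ => (1 : ℝ)) x ∂μ := by
          refine integral_mono ((integrable_const _).indicator hZm)
            (integrable_finsetSum _ hint) fun x => ?_
          by_cases hx : x ∈ Z
          · rw [indicator_of_mem hx]
            refine (hQ' x).trans (le_of_eq ?_)
            rw [Finset.card_filter, Nat.cast_sum]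
            refine Finset.sum_congr rfl fun f hf => ?_
            have := hx f hf
            by_cases hfx : f • x ∈ B <;> simp [hfx, this]
          · rw [indicator_of_notMem hx]
            exact Finset.sum_nonneg fun f _ => indicator_nonneg (fun _ _ => zero_le_one) _
      _ = F.card * μ.real (B \ A) := by
          rw [integral_finsetSum _ hint]
          simp_rw [integral_indicator_const _ (hEm _), smul_eq_mul, mul_one, measureReal_def,
            measure_preimage_smul]
          simp
  have h2 : μ.real Aᶜ ≤ μ.real Z + F.card * η := by
    have hs : Aᶜ ⊆ Z ∪ ⋃ f ∈ F, (f⁻¹ • A \ A) := by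
      intro x hx
      by_cases hxZ : x ∈ Z
      · exact Or.inl hxZ
      · simp only [hZ, mem_ofPred_eq, not_forall, not_not] at hxZ
        obtain ⟨f, hf, hfx⟩ := hxZ
        exact Or.inr (mem_iUnion₂.2 ⟨f, hf, mem_inv_smul_set_iff.2 hfx, hx⟩)
    refine (measureReal_mono hs).trans ((measureReal_union_le _ _).trans ?_)
    gcongr
    refine (measureReal_biUnion_finset_le _ _).trans ((Finset.sum_le_sum hη).trans ?_)
    simp
  have h3 : μ.real Bᶜ = μ.real Aᶜ - μ.real (B \ A) := by
    have : Bᶜ = Aᶜ \ (B \ A) := by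
      ext x
      have := @hsub x
      simp only [mem_compl_iff, mem_sdiff]
      tauto
    rw [this, measureReal_sdiff (show B \ A ⊆ Aᶜ from fun x hx => hx.2) (hB.diff hA)]
  have h4 : ε * μ.real Z ≤ μ.real (B \ A) := by
    refine le_of_mul_le_mul_left ?_ hFpos
    linarith
  have h5 : ε * μ.real Aᶜ ≤ ε * μ.real Z + ε * (F.card * η) := by
    rw [← mul_add]; gcongr
  linarith

end QuasiTiling

/-! ### Open castles for a single invariant measure. -/

section Existence

variable {G : Type*} [Group G] {X : Type*} [MetricSpace X] [MulAction G X]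
  [ContinuousConstSMul G X]

variable (G X) in
/-- A finite family of towers with open bases, `(K, δ)`-invariant shapes, and pairwise disjoint
closed levels of diameter less than `ρ`. -/
structure OpenCastle (K : Finset G) (δ ρ : ℝ) where
  ι : Type
  fintype : Fintype ι
  S : ι → Finset G
  V : ι → Set X
  invariant : ∀ i, IsFolnerInvariant K δ (S i)
  isOpen : ∀ i, IsOpen (V i)
  disjoint : ∀ i j, ∀ s ∈ S i, ∀ t ∈ S j, (i, s) ≠ (j, t) →
    Disjoint (s • closure (V i)) (t • closure (V j))
  diam_lt : ∀ i, ∀ s ∈ S i, Metric.diam (s • closure (V i)) < ρ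

attribute [instance] OpenCastle.fintype

/-- The set covered by the towers. -/
def OpenCastle.carrier {K : Finset G} {δ ρ : ℝ} (C : OpenCastle G X K δ ρ) : Set X :=
  ⋃ j, ⋃ t ∈ C.S j, t • C.V j

theorem OpenCastle.isOpen_carrier {K : Finset G} {δ ρ : ℝ} (C : OpenCastle G X K δ ρ) :
    IsOpen C.carrier :=
  isOpen_iUnion fun j => isOpen_biUnion fun t _ => (C.isOpen j).smul t

/-- Finitely many pairwise disjoint compact levels can be enlarged to open ones. -/
theorem exists_open_towers {ι : Type*} [Finite ι] (S : ι → Finset G) (C : ι → Set X)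
    (hC : ∀ i, IsCompact (C i))
    (hd : ∀ i j, ∀ s ∈ S i, ∀ t ∈ S j, (i, s) ≠ (j, t) → Disjoint (s • C i) (t • C j))
    {ρ : ℝ} (hρ : 0 < ρ) (hdiam : ∀ i, ∀ s ∈ S i, Metric.diam (s • C i) ≤ ρ / 2) :
    ∃ V : ι → Set X, (∀ i, IsOpen (V i)) ∧ (∀ i, C i ⊆ V i) ∧
      (∀ i j, ∀ s ∈ S i, ∀ t ∈ S j, (i, s) ≠ (j, t) →
        Disjoint (s • closure (V i)) (t • closure (V j))) ∧
      ∀ i, ∀ s ∈ S i, Metric.diam (s • closure (V i)) < ρ := by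
  have hsm : ∀ (i : ι) (s : G), IsCompact (s • C i) := fun i s =>
    (hC i).image (continuous_const_smul s)
  have hfin : Finite (Σ i, {s // s ∈ S i}) := inferInstance
  have key : ∀ p q : Σ i, {s // s ∈ S i}, ∃ κ : ℝ, 0 < κ ∧ (p ≠ q →
      Disjoint (Metric.thickening κ (p.2.1 • C p.1)) (Metric.thickening κ (q.2.1 • C q.1))) := by
    rintro ⟨i, s, hs⟩ ⟨j, t, ht⟩
    by_cases h : (⟨i, s, hs⟩ : Σ i, {s // s ∈ S i}) = ⟨j, t, ht⟩
    · exact ⟨1, one_pos, fun h' => (h' h).elim⟩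
    · obtain ⟨κ, hκ, hκd⟩ := (hd i j s hs t ht (by
        rintro h'
        obtain ⟨rfl, rfl⟩ := Prod.mk.inj h'
        exact h rfl)).exists_thickenings (hsm i s) (hsm j t).isClosed
      exact ⟨κ, hκ, fun _ => hκd⟩
  choose κ hκ hκd using key
  -- Thickening by `θ` raises a diameter by at most `2θ ≤ ρ / 4`, so diameters stay at most `3ρ /
  -- 4`.
  obtain ⟨θ, hθ0, hθ⟩ : ∃ θ : ℝ, 0 < θ ∧ θ ≤ ρ / 8 ∧ ∀ p q, θ ≤ κ p q := by
    have : ∀ᶠ θ in nhdsWithin (0 : ℝ) (Ioi 0), 0 < θ ∧ θ ≤ ρ / 8 ∧ ∀ p q, θ ≤ κ p q := by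
      refine Filter.Eventually.and self_mem_nhdsWithin (Filter.Eventually.and ?_ ?_)
      · exact Filter.mem_of_superset (Ioo_mem_nhdsGT (show 0 < ρ / 8 by positivity))
          fun x hx => hx.2.le
      · refine Filter.eventually_all.2 fun p => Filter.eventually_all.2 fun q => ?_
        exact Filter.mem_of_superset (Ioo_mem_nhdsGT (hκ p q)) fun x hx => hx.2.le
    exact this.exists
  have hV : ∀ i, ∃ V : Set X, IsOpen V ∧ C i ⊆ V ∧ closure V ⊆
      ⋂ s ∈ S i, (fun x : X => s • x) ⁻¹' Metric.thickening θ (s • C i) := fun i => by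
    refine normal_exists_closure_subset (hC i).isClosed (isOpen_biInter_finset fun s _ =>
      Metric.isOpen_thickening.preimage (continuous_const_smul s)) ?_
    exact subset_iInter₂ fun s _ x hx => Metric.self_subset_thickening hθ0 _ ⟨x, hx, rfl⟩
  choose V hVo hCV hVcl using hV
  have hlev : ∀ i, ∀ s ∈ S i, s • closure (V i) ⊆ Metric.thickening θ (s • C i) := by
    rintro i s hs _ ⟨x, hx, rfl⟩
    exact mem_iInter₂.1 (hVcl i hx) s hs
  refine ⟨V, hVo, hCV, fun i j s hs t ht hne => ?_, fun i s hs => ?_⟩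
  · have hpq : (⟨i, s, hs⟩ : Σ i, {s // s ∈ S i}) ≠ ⟨j, t, ht⟩ := by
      intro h
      obtain ⟨rfl, h'⟩ := Sigma.mk.inj h
      exact hne (congrArg (Prod.mk i) (Subtype.ext_iff.1 (eq_of_heq h')))
    refine (hκd _ _ hpq).mono ?_ ?_
    · exact (hlev i s hs).trans (Metric.thickening_mono (hθ.2 _ _) _)
    · exact (hlev j t ht).trans (Metric.thickening_mono (hθ.2 _ _) _)
  · have h1 := Metric.diam_mono (hlev i s hs) (hsm i s).isBounded.thickening
    have h2 := Metric.diam_thickening_le (s • C i) hθ0.le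
    linarith [hθ.1, hdiam i s hs]

variable [CompactSpace X]

/-- For a free action, `X` is covered by finitely many small open sets whose translates by the
elements of a given finite set are pairwise disjoint. -/
theorem exists_finset_pieces (hfree : IsFreeAction G X) (F : Finset G) {ρ : ℝ} (hρ : 0 < ρ) :
    ∃ Ps : Finset (Set X), (∀ P ∈ Ps, IsOpen P ∧
      (∀ f ∈ F, ∀ f' ∈ F, f ≠ f' → Disjoint (f • P) (f' • P)) ∧
      ∀ f ∈ F, ∀ V ⊆ P, Metric.diam (f • V) ≤ ρ) ∧ ∀ x, ∃ P ∈ Ps, x ∈ P := by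
  classical
  have key : ∀ x : X, ∃ P : Set X, x ∈ P ∧ IsOpen P ∧
      (∀ f ∈ F, ∀ f' ∈ F, f ≠ f' → Disjoint (f • P) (f' • P)) ∧
      ∀ f ∈ F, ∀ V ⊆ P, Metric.diam (f • V) ≤ ρ := by
    intro x
    have h1 : ∀ f f' : G, f ≠ f' → ∃ U V : Set X, IsOpen U ∧ IsOpen V ∧ f • x ∈ U ∧ f' • x ∈ V ∧
        Disjoint U V := fun f f' hff => t2_separation fun h => hff <| by
      have : (f'⁻¹ * f) • x = x := by rw [mul_smul, h, inv_smul_smul]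
      exact (inv_mul_eq_one.1 (hfree _ _ this)).symm
    choose! U V hU hV hxU hxV hUV using h1
    let W : Set X := (⋂ f ∈ F, ⋂ f' ∈ F, if f ≠ f' then
      ((fun y : X => f • y) ⁻¹' U f f') ∩ ((fun y : X => f' • y) ⁻¹' V f f') else univ) ∩
      ⋂ f ∈ F, (fun y : X => f • y) ⁻¹' Metric.ball (f • x) (ρ / 2)
    refine ⟨W, ?_, ?_, ?_, ?_⟩
    · refine ⟨mem_iInter₂.2 fun f _ => mem_iInter₂.2 fun f' _ => ?_, mem_iInter₂.2 fun f _ => ?_⟩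
      · split_ifs with h
        · exact ⟨hxU _ _ h, hxV _ _ h⟩
        · trivial
      · exact Metric.mem_ball_self (by positivity)
    · refine IsOpen.inter ?_ ?_
      · refine isOpen_biInter_finset fun f _ => isOpen_biInter_finset fun f' _ => ?_
        split_ifs with h
        · exact ((hU _ _ h).preimage (continuous_const_smul f)).inter
            ((hV _ _ h).preimage (continuous_const_smul f'))
        · exact isOpen_univ
      · exact isOpen_biInter_finset fun f _ => Metric.isOpen_ball.preimage (continuous_const_smul f)
    · intro f hf f' hf' hne
      have hW : ∀ y ∈ W, f • y ∈ U f f' ∧ f' • y ∈ V f f' := by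
        intro y hy
        have := mem_iInter₂.1 (mem_iInter₂.1 hy.1 f hf) f' hf'
        rw [if_pos hne] at this
        exact this
      refine (hUV f f' hne).mono ?_ ?_
      · rintro _ ⟨y, hy, rfl⟩; exact (hW y hy).1
      · rintro _ ⟨y, hy, rfl⟩; exact (hW y hy).2
    · intro f hf Y hY
      have : f • Y ⊆ Metric.ball (f • x) (ρ / 2) := by
        rintro _ ⟨y, hy, rfl⟩
        exact mem_iInter₂.1 (hY hy).2 f hf
      refine (Metric.diam_mono this Metric.isBounded_ball).trans ?_
      refine (Metric.diam_ball (by positivity)).trans (by linarith)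
  choose P hxP hP using key
  obtain ⟨t, ht⟩ := isCompact_univ.elim_finite_subcover P (fun x => (hP x).1)
    fun x _ => mem_iUnion.2 ⟨x, hxP x⟩
  refine ⟨t.image P, ?_, fun x => ?_⟩
  · intro Q hQ
    obtain ⟨x, _, rfl⟩ := Finset.mem_image.1 hQ
    exact hP x
  · obtain ⟨y, hy, hxy⟩ := mem_iUnion₂.1 (ht (mem_univ x))
    exact ⟨P y, Finset.mem_image_of_mem _ hy, hxy⟩

variable [MeasurableSpace X] [BorelSpace X]

/-- The order of choices explains the quantifiers in `h`: the Følner set `F` comes first, and only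
then the previous tiling, invariant enough under `F⁻¹` that its error `|F| · 2δ'` is at most `r /
2`. The complement drops to `(1 - ε) r + ε r / 2`. Iterating this makes it arbitrarily small. -/
theorem exists_quasiTiling_step (hG : IsAmenable G) (hfree : IsFreeAction G X) (μ : Measure X)
    [IsProbabilityMeasure μ] [SMulInvariantMeasure G X μ] {ε ρ r : ℝ} (hε0 : 0 < ε)
    (hε : ε ≤ 1 / 2) (hρ : 0 < ρ) (hr : 0 < r)
    (h : ∀ (K : Finset G) (δ : ℝ), 0 < δ →
      ∃ Q : QuasiTiling G X K δ ε ρ, μ.real Q.carrierᶜ ≤ r)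
    (K : Finset G) (δ : ℝ) (hδ : 0 < δ) :
    ∃ Q : QuasiTiling G X K δ ε ρ, μ.real Q.carrierᶜ ≤ (1 - ε / 2) * r := by
  classical
  obtain ⟨F, hF⟩ := hG K δ hδ
  have hFpos : (0 : ℝ) < F.card := by exact_mod_cast hF.1.card_pos
  set δ' := min δ (r / (4 * F.card)) with hδ'
  have hδ'0 : 0 < δ' := lt_min hδ (by positivity)
  obtain ⟨Q₀, hQ₀⟩ := h (K ∪ F.image (·⁻¹)) δ' hδ'0
  set Q := Q₀.mono (δ := δ) (Finset.subset_union_left (s₁ := K)) (min_le_left _ _) with hQ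
  obtain ⟨Ps, hPs, hcov⟩ := exists_finset_pieces hfree F hρ
  obtain ⟨Q', hQQ', hQ'⟩ := Q.exists_extension_of_finset hF (by linarith) Ps
    fun P hP => ⟨(hPs P hP).1.measurableSet, (hPs P hP).2⟩
  refine ⟨Q', ?_⟩
  have hη : ∀ f ∈ F, μ.real (f⁻¹ • Q.carrier \ Q.carrier) ≤ 2 * δ' := fun f hf =>
    Q₀.measureReal_smul_diff_carrier_le μ hε hδ'0.le
      (Finset.mem_union_right _ (Finset.mem_image_of_mem _ hf))
  have h1 := Q.measureReal_compl_carrier_le Q' μ hε0.le hF.1 hQQ'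
    (fun x => let ⟨P, hP, hxP⟩ := hcov x; hQ' P hP x hxP) hη
  have h2 : (F.card : ℝ) * (2 * δ') ≤ r / 2 := by
    have : δ' ≤ r / (4 * F.card) := min_le_right _ _
    calc (F.card : ℝ) * (2 * δ') ≤ F.card * (2 * (r / (4 * F.card))) := by gcongr
      _ = r / 2 := by field_simp; norm_num
  have h3 : μ.real Q.carrierᶜ ≤ r := hQ₀
  have h4 : (1 - ε) * μ.real Q.carrierᶜ ≤ (1 - ε) * r :=
    mul_le_mul_of_nonneg_left h3 (by linarith)
  have h5 : ε * ((F.card : ℝ) * (2 * δ')) ≤ ε * (r / 2) := by gcongr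
  linarith

theorem exists_quasiTiling (hG : IsAmenable G) (hfree : IsFreeAction G X) (μ : Measure X)
    [IsProbabilityMeasure μ] [SMulInvariantMeasure G X μ] {ε ρ r : ℝ} (hε0 : 0 < ε)
    (hε : ε ≤ 1 / 2) (hρ : 0 < ρ) (hr : 0 < r) (K : Finset G) (δ : ℝ) (hδ : 0 < δ) :
    ∃ Q : QuasiTiling G X K δ ε ρ, μ.real Q.carrierᶜ ≤ r := by
  have hpow : ∀ (n : ℕ) (K : Finset G) (δ : ℝ), 0 < δ →
      ∃ Q : QuasiTiling G X K δ ε ρ, μ.real Q.carrierᶜ ≤ (1 - ε / 2) ^ n := by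
    intro n
    induction n with
    | zero => exact fun K δ _ => ⟨.empty, by simp⟩
    | succ n ih =>
      intro K δ hδ
      rw [pow_succ']
      exact exists_quasiTiling_step hG hfree μ hε0 hε hρ (pow_pos (by linarith) n) ih K δ hδ
  obtain ⟨n, hn⟩ := exists_pow_lt_of_lt_one hr (show 1 - ε / 2 < 1 by linarith)
  obtain ⟨Q, hQ⟩ := hpow n K δ hδ
  exact ⟨Q, hQ.trans hn.le⟩

/-- The Ornstein–Weiss tower theorem, with open towers having disjoint closures. -/
theorem exists_openCastle (hG : IsAmenable G) (hfree : IsFreeAction G X) (μ : Measure X)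
    [IsProbabilityMeasure μ] [SMulInvariantMeasure G X μ] (K : Finset G) {δ ρ r : ℝ}
    (hδ : 0 < δ) (hδ1 : δ ≤ 1) (hρ : 0 < ρ) (hr : 0 < r) :
    ∃ C : OpenCastle G X K δ ρ, μ.real C.carrierᶜ < r := by
  -- Dropping a proportion `ε` of a `(K, δ / 2)`-invariant set then leaves a `(K, δ)`-invariant one.
  obtain ⟨ε, hε0, hεK⟩ : ∃ ε : ℝ, 0 < ε ∧ ε * (K.card + 1) = δ / 2 :=
    ⟨δ / 2 / (K.card + 1), by positivity, div_mul_cancel₀ _ (by positivity)⟩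
  have hε1 : ε ≤ 1 / 2 := by
    have : (0 : ℝ) ≤ ε * K.card := by positivity
    linarith
  obtain ⟨Q, hQ⟩ := exists_quasiTiling hG hfree μ hε0 hε1 (half_pos hρ) (show 0 < r / 4 by positivity)
    K (δ / 2) (by positivity)
  have := Q.fin
  have := Fintype.ofFinite Q.ι
  obtain ⟨N, hN⟩ : ∃ N : ℝ, N = ∑ i, ((Q.S i).card : ℝ) := ⟨_, rfl⟩
  have hN0 : 0 ≤ N := hN ▸ Finset.sum_nonneg fun i _ => Nat.cast_nonneg _
  -- Inner regularity gives compact bases. With `N` levels in all the loss is at most `r / 2`, on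
  -- top of the `r / 4` missed by the quasi-tiling.
  have hcpt : ∀ i, ∃ C ⊆ Q.V i, IsCompact C ∧ μ (Q.V i \ C) < ENNReal.ofReal (r / (2 * (N + 1))) :=
    fun i => (Q.measurableSet i).exists_isCompact_sdiff_lt (measure_ne_top _ _)
      (ENNReal.ofReal_pos.2 (by positivity)).ne'
  choose C hCV hC hCμ using hcpt
  have hsubV : ∀ i (s : G), s • C i ⊆ s • Q.V i := fun i s => Set.smul_set_mono (hCV i)
  obtain ⟨V, hVo, hCsub, hVd, hVdiam⟩ := exists_open_towers Q.S C hC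
    (fun i j s hs t ht hne => (Q.disjoint i j s hs t ht hne).mono (hsubV i s) (hsubV j t)) hρ
    fun i s hs => (Metric.diam_mono (hsubV i s) (Metric.isBounded_of_compactSpace)).trans
      (Q.diam_le i s hs)
  refine ⟨⟨Q.ι, inferInstance, Q.S, V, fun i => ?_, hVo, hVd, hVdiam⟩, ?_⟩
  · exact (Q.invariant i).of_subset (Q.subset i) (Q.card_le i) hεK.le (by linarith) hδ1
  · have hs : (⋃ j, ⋃ t ∈ Q.S j, t • V j)ᶜ ⊆
        Q.carrierᶜ ∪ ⋃ j, ⋃ t ∈ Q.S j, t • (Q.V j \ C j) := by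
      intro x hx
      by_cases hxQ : x ∈ Q.carrier
      · refine Or.inr ?_
        simp only [QuasiTiling.carrier, mem_iUnion] at hxQ
        obtain ⟨i, s, hs, y, hy, rfl⟩ := hxQ
        refine mem_iUnion.2 ⟨i, mem_iUnion₂.2 ⟨s, hs, y, ⟨hy, fun hyC => hx ?_⟩, rfl⟩⟩
        exact mem_iUnion.2 ⟨i, mem_iUnion₂.2 ⟨s, hs, y, hCsub i hyC, rfl⟩⟩
      · exact Or.inl hxQ
    have h1 := (measureReal_mono (μ := μ) hs).trans (measureReal_union_le _ _)
    have h2 := measureReal_iUnion_levels_le μ Q.S fun j => Q.V j \ C j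
    have h3 : ∑ j, ((Q.S j).card : ℝ) * μ.real (Q.V j \ C j) ≤
        ∑ j, ((Q.S j).card : ℝ) * (r / (2 * (N + 1))) := by
      refine Finset.sum_le_sum fun j _ => ?_
      gcongr
      exact ENNReal.toReal_le_of_le_ofReal (by positivity) (hCμ j).le
    rw [← Finset.sum_mul, ← hN] at h3
    have h4 : N * (r / (2 * (N + 1))) ≤ r / 2 := by
      rw [mul_div_assoc', div_le_div_iff₀ (by positivity) (by norm_num)]
      nlinarith
    change μ.real (⋃ j, ⋃ t ∈ Q.S j, t • V j)ᶜ < r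
    linarith

end Existence

/-! ### Extreme invariant measures are ergodic. -/

section Ergodicity

variable {G : Type*} [Group G] {X : Type*} [MeasurableSpace X] [MulAction G X]

/-- Extreme points of the invariant probability measures are ergodic. -/
theorem ergodicSMul_of_mem_extreme [TopologicalSpace X] [OpensMeasurableSpace X]
    {μ : ProbabilityMeasure X}
    (h : μ ∈ extremeInvariantMeasures G X) : ErgodicSMul G X (μ : Measure X) := by
  obtain ⟨⟨μ', hμ', hμμ'⟩, hext⟩ := h
  have hinv : SMulInvariantMeasure G X (μ : Measure X) := by
    have hm : SMulInvariantMeasure G X (μ' : Measure X) := hμ'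
    have : (μ' : Measure X) = μ := hμμ'
    rwa [this] at hm
  refine ⟨fun {s} hsm hs => ?_⟩
  by_contra H
  obtain ⟨hs1, hs2⟩ : (μ : Measure X) s ≠ 0 ∧ (μ : Measure X) sᶜ ≠ 0 := by
    simpa [Filter.eventuallyConst_set, ae_iff, and_comm] using! H
  -- `μ` is a convex combination of its conditional measures on `s` and `sᶜ`, both of which are
  -- invariant. Extremality makes `μ` equal to the first, against `μ sᶜ ≠ 0`.
  have hcond : ∀ t : Set X, MeasurableSet t → (μ : Measure X) t ≠ 0 →
      (∀ g : G, (g • ·) ⁻¹' t =ᵐ[(μ : Measure X)] t) →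
      ProbabilityTheory.cond (μ : Measure X) t ∈
        (fun ν : ProbabilityMeasure X => (ν : Measure X)) '' invariantMeasures G X := by
    intro t htm ht0 ht
    refine ⟨⟨ProbabilityTheory.cond (μ : Measure X) t,
      ProbabilityTheory.cond_isProbabilityMeasure ht0⟩, ⟨fun g A hA => ?_⟩, rfl⟩
    change ProbabilityTheory.cond (μ : Measure X) t _ = ProbabilityTheory.cond (μ : Measure X) t A
    rw [ProbabilityTheory.cond_apply htm, ProbabilityTheory.cond_apply htm]
    congr 1
    rw [← SMulInvariantMeasure.measure_preimage_smul (μ := (μ : Measure X)) g (htm.inter hA)]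
    refine measure_congr ?_
    rw [preimage_inter]
    exact ((ht g).symm.inter (ae_eq_refl _))
  have h1 := hext (hcond s hsm hs1 hs) (hcond sᶜ hsm.compl hs2 fun g => by
    rw [preimage_compl]; exact (hs g).compl) ?_
  · rw [← h1] at hs2
    simp [ProbabilityTheory.cond_apply, hsm] at hs2
  · refine ⟨(μ : Measure X) s, (μ : Measure X) sᶜ, pos_iff_ne_zero.2 hs1, pos_iff_ne_zero.2 hs2,
      ?_, ?_⟩
    · rw [measure_add_measure_compl hsm, measure_univ]
    · simp [ProbabilityTheory.cond, smul_smul, ENNReal.mul_inv_cancel, *]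

theorem ErgodicSMul.ae_eq_const_of_forall_ae_eq_comp {μ : Measure X} [ErgodicSMul G X μ]
    {v : X → ℝ} (hv : NullMeasurable v μ) (h : ∀ g : G, (fun x => v (g • x)) =ᵐ[μ] v) :
    ∃ c, v =ᵐ[μ] Function.const X c := by
  refine Filter.exists_eventuallyEq_const_of_forall_separating MeasurableSet fun U hU => ?_
  have := aeconst_of_forall_preimage_smul_ae_eq G (s := v ⁻¹' U) (hv hU) fun g => by
    refine ((h g).mono fun x hx => ?_).set_eq
    simp only [mem_preimage] at hx ⊢
    rw [hx]
  simpa [Filter.eventuallyConst_set] using! this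

end Ergodicity

/-! ### The mean ergodic theorem in Hilbert space. -/

section MeanErgodic

variable {G : Type*} [Group G]

/-- The sum of a bounded function over a Følner set changes little under translation. -/
theorem norm_sum_mul_left_sub_sum_le {E : Type*} [SeminormedAddCommGroup E] {K F : Finset G}
    {δ : ℝ} (hF : IsFolnerInvariant K δ F) {g : G} (hg : g ∈ K) (φ : G → E) {M : ℝ}
    (hM : ∀ s, ‖φ s‖ ≤ M) :
    ‖∑ s ∈ F, φ (g * s) - ∑ s ∈ F, φ s‖ ≤ 2 * (δ * F.card) * M := by
  classical
  have hM0 : 0 ≤ M := (norm_nonneg _).trans (hM 1)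
  have h1 : ∑ s ∈ F, φ (g * s) = ∑ s ∈ F.image (g * ·), φ s := by
    rw [Finset.sum_image fun a _ b _ hab => mul_left_cancel hab]
  have h2 : ((F.image (g * ·) \ F).card : ℝ) ≤ δ * F.card := by
    refine le_trans ?_ (hF.card_filter_notMem_le hg)
    have : F.image (g * ·) \ F ⊆ (F.filter fun s => g * s ∉ F).image (g * ·) := by
      intro x hx
      simp only [Finset.mem_sdiff, Finset.mem_image, Finset.mem_filter] at hx ⊢
      obtain ⟨⟨s, hs, rfl⟩, hx⟩ := hx
      exact ⟨s, ⟨hs, hx⟩, rfl⟩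
    exact_mod_cast (Finset.card_le_card this).trans Finset.card_image_le
  have h3 : ((F \ F.image (g * ·)).card : ℝ) = (F.image (g * ·) \ F).card := by
    have hc : (F.image (g * ·)).card = F.card :=
      Finset.card_image_of_injective _ fun a b hab => mul_left_cancel hab
    exact_mod_cast (Finset.card_sdiff_comm hc).symm
  have hb : ∀ T : Finset G, ‖∑ s ∈ T, φ s‖ ≤ T.card * M := fun T =>
    (norm_sum_le _ _).trans ((Finset.sum_le_sum fun s _ => hM s).trans (by simp))
  rw [h1, ← Finset.sum_sdiff_sub_sum_sdiff]
  calc _ ≤ _ := norm_sub_le _ _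
    _ ≤ (F.image (g * ·) \ F).card * M + (F \ F.image (g * ·)).card * M :=
        add_le_add (hb _) (hb _)
    _ ≤ δ * F.card * M + δ * F.card * M := by rw [h3]; gcongr
    _ = _ := by ring

/-- Von Neumann's mean ergodic theorem for an amenable group: averages over suitable finite sets
of a vector orthogonal to all fixed vectors are small. -/
theorem exists_norm_average_le (hG : IsAmenable G) {H : Type*} [NormedAddCommGroup H]
    [InnerProductSpace ℝ H] [CompleteSpace H] (U : G → H →ₗᵢ[ℝ] H)
    (hU : ∀ g s x, U s (U g x) = U (g * s) x) {x : H}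
    (hx : ∀ v, (∀ g, U g v = v) → inner ℝ v x = 0) {η : ℝ} (hη : 0 < η) :
    ∃ F : Finset G, F.Nonempty ∧ ‖(F.card : ℝ)⁻¹ • ∑ s ∈ F, U s x‖ ≤ η := by
  classical
  -- The coboundaries. A vector orthogonal to all of them is fixed, since `‖U g v - v‖² = 0`, so `x`
  -- is orthogonal to `Wᗮ` and lies in the closure of `W`.
  set W : Submodule ℝ H := Submodule.span ℝ {w | ∃ g h, w = U g h - h} with hW
  have hxW : x ∈ W.topologicalClosure := by
    rw [← Submodule.orthogonal_orthogonal_eq_closure, Submodule.mem_orthogonal]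
    intro v hv
    refine hx v fun g => ?_
    have h1 : inner ℝ (U g v - v) v = 0 :=
      (Submodule.mem_orthogonal W v).1 hv _ (Submodule.subset_span ⟨g, v, rfl⟩)
    rw [inner_sub_left, sub_eq_zero] at h1
    rw [← sub_eq_zero, ← norm_eq_zero, ← sq_eq_zero_iff, norm_sub_sq_real, h1,
      LinearIsometry.norm_map, real_inner_self_eq_norm_sq]
    ring
  -- Smallness is claimed for all sufficiently invariant sets, not just one, so that the conditions
  -- for two summands can be met together.
  have hsmall : ∀ w ∈ W, ∀ ε : ℝ, 0 < ε → ∃ (K : Finset G) (δ : ℝ), 0 < δ ∧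
      ∀ F, IsFolnerInvariant K δ F → ‖(F.card : ℝ)⁻¹ • ∑ s ∈ F, U s w‖ ≤ ε := by
    intro w hw
    induction hw using Submodule.span_induction with
    | mem w hw =>
      obtain ⟨g, h, rfl⟩ := hw
      intro ε hε
      refine ⟨{g}, ε / (2 * ‖h‖ + 1), by positivity, fun F hF => ?_⟩
      have hFpos : (0 : ℝ) < F.card := by exact_mod_cast hF.1.card_pos
      have h1 := norm_sum_mul_left_sub_sum_le hF (Finset.mem_singleton_self g)
        (fun s => U s h) (M := ‖h‖) (fun s => (LinearIsometry.norm_map _ _).le)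
      simp only [map_sub, hU, Finset.sum_sub_distrib]
      rw [norm_smul, norm_inv, Real.norm_natCast, inv_mul_le_iff₀ hFpos]
      refine h1.trans ?_
      have : ε / (2 * ‖h‖ + 1) * (2 * ‖h‖) ≤ ε := by
        rw [div_mul_eq_mul_div, div_le_iff₀ (by positivity)]
        nlinarith [norm_nonneg h]
      nlinarith
    | zero => exact fun ε hε => ⟨∅, 1, one_pos, fun F _ => by simpa using hε.le⟩
    | add w w' _ _ ih ih' =>
      intro ε hε
      obtain ⟨K, δ, hδ, h⟩ := ih (ε / 2) (half_pos hε)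
      obtain ⟨K', δ', hδ', h'⟩ := ih' (ε / 2) (half_pos hε)
      refine ⟨K ∪ K', min δ δ', lt_min hδ hδ', fun F hF => ?_⟩
      have h1 := h F (hF.mono Finset.subset_union_left (min_le_left _ _))
      have h2 := h' F (hF.mono Finset.subset_union_right (min_le_right _ _))
      simp only [map_add, Finset.sum_add_distrib, smul_add]
      exact (norm_add_le _ _).trans (by linarith)
    | smul a w _ ih =>
      intro ε hε
      obtain ⟨K, δ, hδ, h⟩ := ih (ε / (|a| + 1)) (by positivity)
      refine ⟨K, δ, hδ, fun F hF => ?_⟩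
      simp only [map_smul, ← Finset.smul_sum]
      rw [smul_comm, norm_smul, Real.norm_eq_abs]
      calc |a| * _ ≤ |a| * (ε / (|a| + 1)) := by gcongr; exact h F hF
        _ ≤ ε := by
          rw [mul_div_assoc', div_le_iff₀ (by positivity)]
          nlinarith
  obtain ⟨w, hw, hxw⟩ := Metric.mem_closure_iff.1 hxW (η / 2) (half_pos hη)
  obtain ⟨K, δ, hδ, h⟩ := hsmall w hw (η / 2) (half_pos hη)
  obtain ⟨F, hF⟩ := hG K δ hδ
  have hFpos : (0 : ℝ) < F.card := by exact_mod_cast hF.1.card_pos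
  refine ⟨F, hF.1, ?_⟩
  have hsplit : (F.card : ℝ)⁻¹ • ∑ s ∈ F, U s x =
      (F.card : ℝ)⁻¹ • ∑ s ∈ F, U s (x - w) + (F.card : ℝ)⁻¹ • ∑ s ∈ F, U s w := by
    rw [← smul_add, ← Finset.sum_add_distrib]
    simp
  have h1 : ‖(F.card : ℝ)⁻¹ • ∑ s ∈ F, U s (x - w)‖ ≤ η / 2 := by
    rw [norm_smul, norm_inv, Real.norm_natCast, inv_mul_le_iff₀ hFpos]
    refine (norm_sum_le _ _).trans ?_
    simp only [LinearIsometry.norm_map, Finset.sum_const, nsmul_eq_mul]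
    gcongr
    rw [← dist_eq_norm]; exact hxw.le
  rw [hsplit]
  exact (norm_add_le _ _).trans (by linarith [h F hF])

end MeanErgodic

/-! ### Orbit averages of continuous functions. -/

section Averages

variable {G : Type*} [Group G] {X : Type*} [TopologicalSpace X] [MulAction G X]
  [ContinuousConstSMul G X]

/-- The average of `f` over the translates by the elements of `F`. -/
noncomputable def orbitAverage (F : Finset G) (f : C(X, ℝ)) : C(X, ℝ) :=
  (F.card : ℝ)⁻¹ • ∑ s ∈ F, f.comp ⟨fun x => s • x, continuous_const_smul s⟩

theorem orbitAverage_apply (F : Finset G) (f : C(X, ℝ)) (x : X) :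
    orbitAverage F f x = (F.card : ℝ)⁻¹ * ∑ s ∈ F, f (s • x) := by
  simp [orbitAverage]

theorem orbitAverage_sub_const {F : Finset G} (hF : F.Nonempty) (f : C(X, ℝ)) (c : ℝ) (x : X) :
    orbitAverage F (f - ContinuousMap.const X c) x = orbitAverage F f x - c := by
  have : (F.card : ℝ) ≠ 0 := by exact_mod_cast hF.card_pos.ne'
  simp only [orbitAverage_apply, ContinuousMap.sub_apply, ContinuousMap.const_apply,
    Finset.sum_sub_distrib, Finset.sum_const, nsmul_eq_mul]
  field_simp

theorem sq_orbitAverage_le {F : Finset G} (hF : F.Nonempty) (f : C(X, ℝ)) (x : X) :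
    orbitAverage F f x ^ 2 ≤ (F.card : ℝ)⁻¹ * ∑ s ∈ F, f (s • x) ^ 2 := by
  have hFpos : (0 : ℝ) < F.card := by exact_mod_cast hF.card_pos
  rw [orbitAverage_apply, mul_pow]
  have := sq_sum_le_card_mul_sum_sq (s := F) (f := fun s => f (s • x))
  calc _ ≤ ((F.card : ℝ)⁻¹) ^ 2 * (F.card * ∑ s ∈ F, f (s • x) ^ 2) := by gcongr
    _ = _ := by field_simp

variable [CompactSpace X]

theorem abs_orbitAverage_le {F : Finset G} (hF : F.Nonempty) (f : C(X, ℝ)) (x : X) :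
    |orbitAverage F f x| ≤ ‖f‖ := by
  have hFpos : (0 : ℝ) < F.card := by exact_mod_cast hF.card_pos
  rw [orbitAverage_apply, abs_mul, abs_inv, Nat.abs_cast, inv_mul_le_iff₀ hFpos]
  refine (Finset.abs_sum_le_sum_abs _ _).trans ((Finset.sum_le_sum fun s _ =>
    f.norm_coe_le_norm (s • x)).trans ?_)
  simp

/-- The double average is the mean over `k ∈ F` of averages over `k F'`, and each `k F'` nearly
equals `F'`. Thereby `L²` decay obtained for `F` passes to every `F'` invariant enough under `F`. -/
theorem abs_orbitAverage_orbitAverage_sub_le {F F' : Finset G} {δ : ℝ} (hF : F.Nonempty)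
    (hF' : IsFolnerInvariant F δ F') (f : C(X, ℝ)) (x : X) :
    |orbitAverage F' (orbitAverage F f) x - orbitAverage F' f x| ≤ 2 * δ * ‖f‖ := by
  have hFpos : (0 : ℝ) < F.card := by exact_mod_cast hF.card_pos
  have hFpos' : (0 : ℝ) < F'.card := by exact_mod_cast hF'.1.card_pos
  have h1 : orbitAverage F' (orbitAverage F f) x - orbitAverage F' f x =
      (F.card : ℝ)⁻¹ * ∑ k ∈ F, (F'.card : ℝ)⁻¹ *
        (∑ s ∈ F', f ((k * s) • x) - ∑ s ∈ F', f (s • x)) := by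
    simp only [orbitAverage_apply, ← Finset.mul_sum, Finset.sum_sub_distrib, Finset.sum_const,
      nsmul_eq_mul, smul_smul]
    rw [Finset.sum_comm]
    field_simp
  rw [h1, abs_mul, abs_inv, Nat.abs_cast, inv_mul_le_iff₀ hFpos]
  refine (Finset.abs_sum_le_sum_abs _ _).trans ((Finset.sum_le_sum (g := fun _ => 2 * δ * ‖f‖)
    fun k hk => ?_).trans (le_of_eq (by simp)))
  rw [abs_mul, abs_inv, Nat.abs_cast, inv_mul_le_iff₀ hFpos']
  have := norm_sum_mul_left_sub_sum_le hF' hk (fun s => f (s • x)) (M := ‖f‖)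
    fun s => f.norm_coe_le_norm _
  rw [Real.norm_eq_abs] at this
  linarith

variable [MeasurableSpace X] [BorelSpace X]

theorem integrable_continuousMap (μ : Measure X) [IsFiniteMeasure μ]
    (f : C(X, ℝ)) : Integrable (fun x => f x) μ :=
  f.continuous.integrable_of_hasCompactSupport (HasCompactSupport.of_compactSpace _)

theorem integral_orbitAverage (μ : Measure X) [IsFiniteMeasure μ] [SMulInvariantMeasure G X μ]
    {F : Finset G} (hF : F.Nonempty) (f : C(X, ℝ)) :
    ∫ x, orbitAverage F f x ∂μ = ∫ x, f x ∂μ := by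
  have hFpos : (F.card : ℝ) ≠ 0 := by exact_mod_cast hF.card_pos.ne'
  simp_rw [orbitAverage_apply]
  have hint : ∀ s ∈ F, Integrable (fun x => f (s • x)) μ := fun s _ => integrable_continuousMap μ
    (f.comp ⟨fun x => s • x, continuous_const_smul s⟩)
  rw [integral_const_mul, integral_finsetSum _ hint]
  simp_rw [integral_smul_eq_self (μ := μ) (fun x => f x)]
  simp [hFpos]

end Averages

/-! ### Uniform mean ergodic theorem on a compact set of ergodic measures. -/

section MeanErgodicCompact

variable {G : Type*} [Group G] {X : Type*} [MetricSpace X] [CompactSpace X] [MeasurableSpace X]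
  [BorelSpace X] [MulAction G X] [ContinuousConstSMul G X]

theorem smulInvariant_of_mem_extreme {μ : ProbabilityMeasure X}
    (h : μ ∈ extremeInvariantMeasures G X) : SMulInvariantMeasure G X (μ : Measure X) :=
  (ergodicSMul_of_mem_extreme h).toSMulInvariantMeasure

/-- The mean ergodic theorem for the Koopman operators on `L²(μ)`, which reverse products. Their
fixed vectors are constant by ergodicity, hence orthogonal to `f`. -/
theorem exists_integral_sq_orbitAverage_lt (hG : IsAmenable G) (μ : Measure X)
    [IsProbabilityMeasure μ] [ErgodicSMul G X μ] (f : C(X, ℝ)) (hf : ∫ x, f x ∂μ = 0) {η : ℝ}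
    (hη : 0 < η) : ∃ F : Finset G, F.Nonempty ∧ ∫ x, orbitAverage F f x ^ 2 ∂μ < η := by
  have hmp : ∀ g : G, MeasurePreserving (fun x : X => g • x) μ μ := fun g =>
    measurePreserving_smul g μ
  have hU : ∀ (g s : G) (v : Lp ℝ 2 μ), Lp.compMeasurePreserving _ (hmp s)
      (Lp.compMeasurePreserving _ (hmp g) v) = Lp.compMeasurePreserving _ (hmp (g * s)) v := by
    intro g s v
    rw [← Lp.compMeasurePreserving_comp_apply v (hmp g) (hmp s)]
    congr 2
    ext x
    simp [mul_smul]
  obtain ⟨F, hF, hFη⟩ := exists_norm_average_le hG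
    (fun g => Lp.compMeasurePreservingₗᵢ ℝ (fun x : X => g • x) (hmp g)) hU
    (x := ContinuousMap.toLp 2 μ ℝ f) (fun v hv => by
      have hv' : ∀ g : G, (fun x => v (g • x)) =ᵐ[μ] v := by
        intro g
        have h1 := Lp.coeFn_compMeasurePreserving v (hmp g)
        have h2 : Lp.compMeasurePreserving _ (hmp g) v = v := hv g
        rw [h2] at h1
        exact h1.symm
      obtain ⟨c, hc⟩ := ErgodicSMul.ae_eq_const_of_forall_ae_eq_comp (G := G)
        (Lp.aestronglyMeasurable v).aemeasurable.nullMeasurable hv'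
      rw [L2.inner_def]
      have : ∀ᵐ a ∂μ, inner ℝ (v a) (ContinuousMap.toLp 2 μ ℝ f a) = c * f a := by
        filter_upwards [hc, ContinuousMap.coeFn_toLp (p := 2) (𝕜 := ℝ) μ f] with a ha hfa
        rw [hfa, ha]
        simp [mul_comm]
      rw [integral_congr_ae this, integral_const_mul, hf, mul_zero])
    (η := Real.sqrt η / 2) (by positivity)
  refine ⟨F, hF, ?_⟩
  have h1 : (F.card : ℝ)⁻¹ • ∑ s ∈ F, (Lp.compMeasurePreservingₗᵢ ℝ (fun x : X => s • x) (hmp s))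
      (ContinuousMap.toLp 2 μ ℝ f) = ContinuousMap.toLp 2 μ ℝ (orbitAverage F f) := by
    rw [orbitAverage, map_smul, map_sum]
    rfl
  have h2 : ‖ContinuousMap.toLp 2 μ ℝ (orbitAverage F f)‖ ^ 2 = ∫ x, orbitAverage F f x ^ 2 ∂μ := by
    rw [← real_inner_self_eq_norm_sq, ContinuousMap.inner_toLp]
    simp [sq]
  rw [h1] at hFη
  rw [← h2]
  calc _ ≤ (Real.sqrt η / 2) ^ 2 := by gcongr
    _ = η / 4 := by rw [div_pow, Real.sq_sqrt hη.le]; norm_num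
    _ < η := by linarith

/-- The variance formula; its right-hand side is visibly weak* continuous in `μ`. -/
theorem integral_sq_orbitAverage_sub (μ : Measure X) [IsProbabilityMeasure μ]
    [SMulInvariantMeasure G X μ] {F : Finset G} (hF : F.Nonempty) (f : C(X, ℝ)) :
    ∫ x, (orbitAverage F f x - ∫ y, f y ∂μ) ^ 2 ∂μ =
      ∫ x, orbitAverage F f x ^ 2 ∂μ - (∫ x, f x ∂μ) ^ 2 := by
  set c := ∫ y, f y ∂μ with hc
  have h1 : ∀ x, (orbitAverage F f x - c) ^ 2 =
      orbitAverage F f x ^ 2 - (2 * c) * orbitAverage F f x + c ^ 2 := fun x => by ring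
  simp_rw [h1]
  have i1 : Integrable (fun x => orbitAverage F f x ^ 2) μ :=
    integrable_continuousMap μ (orbitAverage F f ^ 2)
  have i2 : Integrable (fun x => 2 * c * orbitAverage F f x) μ :=
    (integrable_continuousMap μ (orbitAverage F f)).const_mul _
  have i3 : Integrable (fun x => orbitAverage F f x ^ 2 - 2 * c * orbitAverage F f x) μ := i1.sub i2
  rw [integral_add i3 (integrable_const _), integral_sub i1 i2,
    integral_const_mul, integral_orbitAverage μ hF, ← hc]
  simp
  ring

theorem integral_sq_orbitAverage_le (μ : Measure X) [IsProbabilityMeasure μ]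
    [SMulInvariantMeasure G X μ] {F : Finset G} (hF : F.Nonempty) (f : C(X, ℝ)) :
    ∫ x, orbitAverage F f x ^ 2 ∂μ ≤ ∫ x, f x ^ 2 ∂μ := by
  have i1 : Integrable (fun x => orbitAverage F f x ^ 2) μ :=
    integrable_continuousMap μ (orbitAverage F f ^ 2)
  have i2 := integrable_continuousMap μ (orbitAverage F (f ^ 2))
  calc _ ≤ ∫ x, orbitAverage F (f ^ 2) x ∂μ := by
        refine integral_mono i1 i2 fun x => ?_
        have := sq_orbitAverage_le hF f x
        rw [orbitAverage_apply F (f ^ 2)]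
        exact this
    _ = _ := by rw [integral_orbitAverage μ hF]; rfl

/-- On a compact set of ergodic measures, orbit averages converge to the mean uniformly in `L²`. -/
theorem exists_orbitAverage_uniform (hG : IsAmenable G)
    (hE : IsCompact (extremeInvariantMeasures G X)) (f : C(X, ℝ)) {η : ℝ} (hη : 0 < η) :
    ∃ F : Finset G, F.Nonempty ∧ ∀ ν ∈ extremeInvariantMeasures G X,
      ∫ x, (orbitAverage F f x - ∫ y, f y ∂(ν : Measure X)) ^ 2 ∂(ν : Measure X) < η := by
  classical
  let w : Finset G → ProbabilityMeasure X → ℝ := fun F ν =>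
    ∫ x, orbitAverage F f x ^ 2 ∂(ν : Measure X) - (∫ x, f x ∂(ν : Measure X)) ^ 2
  have hw : ∀ F, Continuous (w F) := fun F =>
    (ProbabilityMeasure.continuous_integral_continuousMap (orbitAverage F f ^ 2)).sub
      ((ProbabilityMeasure.continuous_integral_continuousMap f).pow 2)
  have hpt : ∀ ν ∈ extremeInvariantMeasures G X, ∃ F : Finset G, F.Nonempty ∧ w F ν < η / 2 := by
    intro ν hν
    have := ergodicSMul_of_mem_extreme hν
    set c := ∫ y, f y ∂(ν : Measure X) with hc
    obtain ⟨F, hF, h⟩ := exists_integral_sq_orbitAverage_lt hG (ν : Measure X)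
      (f - ContinuousMap.const X c) (by
        simp only [ContinuousMap.sub_apply, ContinuousMap.const_apply]
        rw [integral_sub (integrable_continuousMap _ f) (integrable_const _)]
        simp [hc]) (half_pos hη)
    refine ⟨F, hF, ?_⟩
    simp_rw [orbitAverage_sub_const hF] at h
    rwa [hc, integral_sq_orbitAverage_sub _ hF] at h
  choose! F hF hFw using hpt
  -- Finitely many sets `F ν` suffice on all of `E`. One `F'` invariant under all of them replaces
  -- them: averaging over `F'` contracts the `L²` norm, and the error `4δ‖f‖²` is at most `η / 2`.
  obtain ⟨t, htE, ht⟩ := hE.elim_nhds_subcover (fun ν => {ν' | w (F ν) ν' < η / 2}) fun ν hν =>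
    (isOpen_lt (hw (F ν)) continuous_const).mem_nhds (hFw ν hν)
  set δ : ℝ := η / (2 * (4 * ‖f‖ ^ 2 + 1)) with hδ
  obtain ⟨F', hF'⟩ := hG (t.biUnion F) δ (by positivity)
  refine ⟨F', hF'.1, fun ν hν => ?_⟩
  have := smulInvariant_of_mem_extreme hν
  rw [integral_sq_orbitAverage_sub _ hF'.1]
  obtain ⟨ν', hν', hνν'⟩ := mem_iUnion₂.1 (ht hν)
  have hFν' := hF ν' (htE ν' hν')
  have hinv : IsFolnerInvariant (F ν') δ F' := hF'.mono (Finset.subset_biUnion_of_mem F hν') le_rfl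
  have hle : ∫ x, orbitAverage F' f x ^ 2 ∂(ν : Measure X) ≤
      ∫ x, orbitAverage (F ν') f x ^ 2 ∂(ν : Measure X) + 4 * δ * ‖f‖ ^ 2 := by
    refine le_trans ?_ (add_le_add_left
      (integral_sq_orbitAverage_le (ν : Measure X) hF'.1 (orbitAverage (F ν') f)) _)
    have i1 : Integrable (fun x => orbitAverage F' f x ^ 2) (ν : Measure X) :=
      integrable_continuousMap _ (orbitAverage F' f ^ 2)
    have i2 : Integrable (fun x => orbitAverage F' (orbitAverage (F ν') f) x ^ 2) (ν : Measure X) :=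
      integrable_continuousMap _ (orbitAverage F' (orbitAverage (F ν') f) ^ 2)
    calc _ ≤ ∫ x, (orbitAverage F' (orbitAverage (F ν') f) x ^ 2 + 4 * δ * ‖f‖ ^ 2)
          ∂(ν : Measure X) := by
          refine integral_mono i1 (i2.add (integrable_const _)) fun x => ?_
          set a := orbitAverage F' f x
          set b := orbitAverage F' (orbitAverage (F ν') f) x
          have h1 : |b - a| ≤ 2 * δ * ‖f‖ := abs_orbitAverage_orbitAverage_sub_le hFν' hinv f x
          have h2 : |a| ≤ ‖f‖ := abs_orbitAverage_le hF'.1 f x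
          have h3 : |b| ≤ ‖f‖ := by
            refine (abs_orbitAverage_le hF'.1 _ x).trans ?_
            exact (ContinuousMap.norm_le _ (norm_nonneg _)).2 fun y => abs_orbitAverage_le hFν' f y
          have h4 : |b + a| ≤ 2 * ‖f‖ := (abs_add_le _ _).trans (by linarith)
          have h5 : |(b - a) * (b + a)| ≤ 2 * δ * ‖f‖ * (2 * ‖f‖) := by
            rw [abs_mul]
            exact mul_le_mul h1 h4 (abs_nonneg _) ((abs_nonneg _).trans h1)
          have h6 := (abs_le.1 h5).1
          change a ^ 2 ≤ b ^ 2 + 4 * δ * ‖f‖ ^ 2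
          nlinarith
      _ = _ := by
          rw [integral_add i2 (integrable_const _)]
          simp
  have hδf : 4 * δ * ‖f‖ ^ 2 ≤ η / 2 := by
    have : δ * (4 * ‖f‖ ^ 2 + 1) = η / 2 := by rw [hδ]; field_simp
    have hδ0 : 0 < δ := by positivity
    linarith
  have h6 : w (F ν') ν < η / 2 := hνν'
  simp only [w] at h6
  linarith

end MeanErgodicCompact

/-! ### Density of integrals in the continuous functions on the ergodic measures. -/

section Density

variable {G : Type*} [Group G] {X : Type*} [MetricSpace X] [CompactSpace X] [MeasurableSpace X]
  [BorelSpace X] [MulAction G X] [ContinuousConstSMul G X]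

/-- Integration of continuous functions on `X`, as a map into the continuous functions on a set of
probability measures. -/
noncomputable def integralMap (E : Set (ProbabilityMeasure X)) : C(X, ℝ) →ₗ[ℝ] C(E, ℝ) where
  toFun f := ⟨fun ν => ∫ x, f x ∂((ν : ProbabilityMeasure X) : Measure X),
    (ProbabilityMeasure.continuous_integral_continuousMap f).comp continuous_subtype_val⟩
  map_add' f g := by
    ext ν
    exact integral_add (integrable_continuousMap _ f) (integrable_continuousMap _ g)
  map_smul' c f := by
    ext ν
    exact integral_const_mul c _

theorem integralMap_apply (E : Set (ProbabilityMeasure X)) (f : C(X, ℝ)) (ν : E) :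
    integralMap E f ν = ∫ x, f x ∂((ν : ProbabilityMeasure X) : Measure X) := rfl

/-- Since the orbit average of `f` is `L²(ν)`-close to the constant `∫ f dν`, its product with `g`
has integral close to `∫ f dν · ∫ g dν`, uniformly in `ν`. -/
theorem integralMap_mul_mem_closure (hG : IsAmenable G)
    (hE : IsCompact (extremeInvariantMeasures G X)) (f g : C(X, ℝ)) :
    integralMap (extremeInvariantMeasures G X) f * integralMap (extremeInvariantMeasures G X) g ∈
      closure (range (integralMap (extremeInvariantMeasures G X))) := by
  have : CompactSpace (extremeInvariantMeasures G X) := isCompact_iff_compactSpace.1 hE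
  rw [Metric.mem_closure_range_iff]
  intro ε hε
  -- The weight in `|a|‖g‖ ≤ a² / (2κ) + κ‖g‖² / 2`. The two terms contribute at most `ε / 4` and `ε
  -- / 2`.
  set κ : ℝ := ε / (‖g‖ ^ 2 + 1) with hκ
  have hκ0 : 0 < κ := by positivity
  have hκg : κ * ‖g‖ ^ 2 ≤ ε := by
    have : κ * (‖g‖ ^ 2 + 1) = ε := by rw [hκ]; field_simp
    linarith
  obtain ⟨F, hF, h⟩ := exists_orbitAverage_uniform hG hE f (show 0 < κ * (ε / 2) by positivity)
  refine ⟨orbitAverage F f * g, ?_⟩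
  refine (ContinuousMap.dist_le (C := 3 / 4 * ε) (by positivity)).2 (fun ν => ?_) |>.trans_lt
    (by linarith)
  have hν := h ν ν.2
  set m : Measure X := ((ν : ProbabilityMeasure X) : Measure X) with hm
  have i1 : Integrable (fun x => (orbitAverage F f * g) x) m := integrable_continuousMap _ _
  have i2 : Integrable (fun x => g x) m := integrable_continuousMap _ _
  have i3 : Integrable (fun x => (orbitAverage F f x - ∫ y, f y ∂m) ^ 2) m :=
    integrable_continuousMap _ ((orbitAverage F f - ContinuousMap.const X (∫ y, f y ∂m)) ^ 2)
  have e1 : (integralMap (extremeInvariantMeasures G X) f *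
        integralMap (extremeInvariantMeasures G X) g) ν -
      integralMap (extremeInvariantMeasures G X) (orbitAverage F f * g) ν =
      -∫ x, (orbitAverage F f x - ∫ y, f y ∂m) * g x ∂m := by
    simp only [ContinuousMap.mul_apply, integralMap_apply, ← hm, sub_mul] at i1 ⊢
    rw [integral_sub i1 (i2.const_mul _), integral_const_mul]
    ring
  rw [Real.dist_eq, e1, abs_neg]
  calc _ ≤ ∫ x, |(orbitAverage F f x - ∫ y, f y ∂m) * g x| ∂m := abs_integral_le_integral_abs
    _ ≤ ∫ x, ((2 * κ)⁻¹ * (orbitAverage F f x - ∫ y, f y ∂m) ^ 2 + κ * ‖g‖ ^ 2 / 2) ∂m := by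
        refine integral_mono (integrable_continuousMap _ (|(orbitAverage F f -
          ContinuousMap.const X (∫ y, f y ∂m)) * g|)) ((i3.const_mul _).add (integrable_const _))
          fun x => ?_
        set a := orbitAverage F f x - ∫ y, f y ∂m
        have hg : |g x| ≤ ‖g‖ := g.norm_coe_le_norm x
        change |a * g x| ≤ (2 * κ)⁻¹ * a ^ 2 + κ * ‖g‖ ^ 2 / 2
        have : (2 * κ)⁻¹ * a ^ 2 + κ * ‖g‖ ^ 2 / 2 =
            |a| * ‖g‖ + (2 * κ)⁻¹ * (|a| - κ * ‖g‖) ^ 2 := by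
          rw [← sq_abs a]; field_simp; ring
        rw [this, abs_mul]
        have h1 : |a| * |g x| ≤ |a| * ‖g‖ := by gcongr
        have h2 : 0 ≤ (2 * κ)⁻¹ * (|a| - κ * ‖g‖) ^ 2 := by positivity
        linarith
    _ = (2 * κ)⁻¹ * ∫ x, (orbitAverage F f x - ∫ y, f y ∂m) ^ 2 ∂m + κ * ‖g‖ ^ 2 / 2 := by
        rw [integral_add (i3.const_mul _) (integrable_const _), integral_const_mul]
        simp
    _ ≤ (2 * κ)⁻¹ * (κ * (ε / 2)) + ε / 2 := by gcongr
    _ = 3 / 4 * ε := by field_simp; norm_num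

/-- On a compact set of ergodic measures, every continuous function is approximately given by
integration of a continuous function on `X`. -/
theorem dense_range_integralMap (hG : IsAmenable G)
    (hE : IsCompact (extremeInvariantMeasures G X)) :
    DenseRange (integralMap (extremeInvariantMeasures G X)) := by
  have : CompactSpace (extremeInvariantMeasures G X) := isCompact_iff_compactSpace.1 hE
  set Φ := integralMap (extremeInvariantMeasures G X) with hΦ
  set W : Submodule ℝ C(extremeInvariantMeasures G X, ℝ) :=
    (LinearMap.range Φ).topologicalClosure with hW
  have hWcl : (W : Set C(extremeInvariantMeasures G X, ℝ)) = closure (range Φ) := rfl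
  have hone : (1 : C(extremeInvariantMeasures G X, ℝ)) ∈ W := by
    refine subset_closure ⟨1, ?_⟩
    ext ν
    simp [hΦ, integralMap_apply]
  have hmul : ∀ a b, a ∈ W → b ∈ W → a * b ∈ W := by
    intro a b ha hb
    have := map_mem_closure₂ (f := fun a b : C(extremeInvariantMeasures G X, ℝ) => a * b)
      (u := closure (range Φ)) continuous_mul ha hb (by
        rintro _ ⟨f, rfl⟩ _ ⟨g, rfl⟩
        exact integralMap_mul_mem_closure hG hE f g)
    rwa [closure_closure] at this
  -- Stone–Weierstrass; points are separated because a finite measure is determined by its integrals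
  -- of continuous functions.
  have htop := ContinuousMap.subalgebra_topologicalClosure_eq_top_of_separatesPoints
    (W.toSubalgebra hone hmul) (by
      intro ν ν' hne
      by_contra hcon
      push Not at hcon
      refine hne (Subtype.ext (ProbabilityMeasure.toMeasure_injective ?_))
      refine ext_of_forall_integral_eq_of_IsFiniteMeasure fun f => ?_
      exact hcon _ ⟨Φ f.toContinuousMap, subset_closure ⟨_, rfl⟩, rfl⟩)
  intro h
  have hh : h ∈ (W.toSubalgebra hone hmul).topologicalClosure := htop ▸ Algebra.mem_top
  have h2 : h ∈ closure (W : Set C(extremeInvariantMeasures G X, ℝ)) := hh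
  rwa [hWcl, closure_closure] at h2

end Density

/-! ### From extreme to all invariant measures. -/

section KreinMilman

variable {G : Type*} [Group G] {X : Type*} [MetricSpace X] [CompactSpace X] [MeasurableSpace X]
  [BorelSpace X] [MulAction G X] [ContinuousConstSMul G X]

/-- A probability measure as a functional on continuous functions. -/
noncomputable def integralFunctional (μ : ProbabilityMeasure X) : C(X, ℝ) → ℝ :=
  fun f => ∫ x, f x ∂(μ : Measure X)

theorem continuous_integralFunctional :
    Continuous (integralFunctional : ProbabilityMeasure X → C(X, ℝ) → ℝ) :=
  continuous_pi fun f => ProbabilityMeasure.continuous_integral_continuousMap f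

theorem integralFunctional_injective :
    Function.Injective (integralFunctional : ProbabilityMeasure X → C(X, ℝ) → ℝ) := by
  intro μ ν h
  refine ProbabilityMeasure.toMeasure_injective ?_
  exact ext_of_forall_integral_eq_of_IsFiniteMeasure fun f => congrFun h f.toContinuousMap

variable (G X) in
theorem isClosed_invariantMeasures : IsClosed (invariantMeasures G X) := by
  have : invariantMeasures G X = ⋂ g : G,
      {μ | μ.map (continuous_const_smul g).measurable.aemeasurable = μ} := by
    ext μ
    simp only [mem_iInter, mem_ofPred_eq, invariantMeasures]
    constructor
    · intro h g
      refine ProbabilityMeasure.toMeasure_injective ?_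
      exact (measurePreserving_smul g (μ : Measure X)).map_eq
    · intro h
      refine ⟨fun g s hs => ?_⟩
      have h1 := congrArg (fun ν : ProbabilityMeasure X => (ν : Measure X) s) (h g)
      simp only [ProbabilityMeasure.toMeasure_map] at h1
      rwa [Measure.map_apply (continuous_const_smul g).measurable hs] at h1
  rw [this]
  exact isClosed_iInter fun g =>
    isClosed_eq (ProbabilityMeasure.continuous_map (continuous_const_smul g)) continuous_id

/-- The convex combination of two probability measures. -/
theorem exists_combination (μ ν : ProbabilityMeasure X) {a b : ℝ} (ha : 0 ≤ a) (hb : 0 ≤ b)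
    (hab : a + b = 1) : ∃ ξ : ProbabilityMeasure X,
      (ξ : Measure X) = ENNReal.ofReal a • (μ : Measure X) + ENNReal.ofReal b • (ν : Measure X) ∧
      integralFunctional ξ = a • integralFunctional μ + b • integralFunctional ν := by
  have hp : IsProbabilityMeasure
      (ENNReal.ofReal a • (μ : Measure X) + ENNReal.ofReal b • (ν : Measure X)) := by
    constructor
    simp [← ENNReal.ofReal_add ha hb, hab]
  refine ⟨⟨_, hp⟩, rfl, ?_⟩
  ext f
  change ∫ x, f x ∂(ENNReal.ofReal a • (μ : Measure X) + ENNReal.ofReal b • (ν : Measure X)) = _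
  rw [integral_add_measure ((integrable_continuousMap _ f).smul_measure ENNReal.ofReal_ne_top)
    ((integrable_continuousMap _ f).smul_measure ENNReal.ofReal_ne_top), integral_smul_measure,
    integral_smul_measure, ENNReal.toReal_ofReal ha, ENNReal.toReal_ofReal hb]
  rfl

theorem convex_integralFunctional_image :
    Convex ℝ (integralFunctional '' invariantMeasures G X) := by
  rintro _ ⟨μ, hμ, rfl⟩ _ ⟨ν, hν, rfl⟩ a b ha hb hab
  obtain ⟨ξ, hξ, hξ'⟩ := exists_combination μ ν ha hb hab
  refine ⟨ξ, ⟨fun g s hs => ?_⟩, hξ'⟩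
  have hμ' : SMulInvariantMeasure G X (μ : Measure X) := hμ
  have hν' : SMulInvariantMeasure G X (ν : Measure X) := hν
  rw [hξ]
  simp

/-- Reconciles extremality with real weights, as in Krein–Milman, and with `ℝ≥0∞` weights: weights
summing to 1 are finite. -/
theorem mem_extreme_of_integralFunctional {μ : ProbabilityMeasure X}
    (h : integralFunctional μ ∈ extremePoints ℝ (integralFunctional '' invariantMeasures G X)) :
    μ ∈ extremeInvariantMeasures G X := by
  obtain ⟨⟨μ', hμ', hμμ'⟩, hext⟩ := h
  obtain rfl := integralFunctional_injective hμμ'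
  refine ⟨⟨μ', hμ', rfl⟩, ?_⟩
  rintro _ ⟨ν₁, hν₁, rfl⟩ _ ⟨ν₂, hν₂, rfl⟩ ⟨a, b, ha, hb, hab, hsum⟩
  have ha1 : a ≠ ∞ := ne_top_of_le_ne_top ENNReal.one_ne_top (hab ▸ le_self_add)
  have hb1 : b ≠ ∞ := ne_top_of_le_ne_top ENNReal.one_ne_top (hab ▸ le_add_self)
  have hab' : a.toReal + b.toReal = 1 := by rw [← ENNReal.toReal_add ha1 hb1, hab]; rfl
  obtain ⟨ξ, hξ, hξ'⟩ := exists_combination ν₁ ν₂ ENNReal.toReal_nonneg ENNReal.toReal_nonneg hab'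
  have hξμ : ξ = μ' := by
    refine ProbabilityMeasure.toMeasure_injective ?_
    rw [hξ, ENNReal.ofReal_toReal ha1, ENNReal.ofReal_toReal hb1]
    exact hsum
  have := hext ⟨ν₁, hν₁, rfl⟩ ⟨ν₂, hν₂, rfl⟩ ⟨a.toReal, b.toReal, ENNReal.toReal_pos ha.ne' ha1,
    ENNReal.toReal_pos hb.ne' hb1, hab', by rw [← hξ', hξμ]⟩
  exact congrArg _ (integralFunctional_injective this)

/-- An upper bound for the integral of a continuous function that holds for all extreme invariant
measures holds for all invariant measures. -/
theorem integral_le_of_forall_extreme (f : C(X, ℝ)) {a : ℝ}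
    (h : ∀ ν ∈ extremeInvariantMeasures G X, ∫ x, f x ∂(ν : Measure X) ≤ a)
    {μ : ProbabilityMeasure X} (hμ : μ ∈ invariantMeasures G X) :
    ∫ x, f x ∂(μ : Measure X) ≤ a := by
  -- Krein–Milman in `C(X, ℝ) → ℝ` with the product topology, where the bound on `∫ f` is a closed
  -- half-space.
  have hcpt : IsCompact (integralFunctional '' invariantMeasures G X) :=
    (isClosed_invariantMeasures G X).isCompact.image continuous_integralFunctional
  have hmem : integralFunctional μ ∈ closure (convexHull ℝ
      (extremePoints ℝ (integralFunctional '' invariantMeasures G X))) := by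
    rw [closure_convexHull_extremePoints hcpt convex_integralFunctional_image]
    exact ⟨μ, hμ, rfl⟩
  have hsub : closure (convexHull ℝ (extremePoints ℝ
      (integralFunctional '' invariantMeasures G X))) ⊆ {φ : C(X, ℝ) → ℝ | φ f ≤ a} := by
    refine closure_minimal (convexHull_min ?_ ?_) (isClosed_le (continuous_apply f)
      continuous_const)
    · intro φ hφ
      obtain ⟨ν, -, rfl⟩ := hφ.1
      exact h ν (mem_extreme_of_integralFunctional hφ)
    · exact convex_halfSpace_le (f := fun φ : C(X, ℝ) → ℝ => φ f)
        ⟨fun _ _ => rfl, fun _ _ => rfl⟩ a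
  exact hsub hmem

theorem exists_continuous_indicator_le (μ : Measure X) [IsProbabilityMeasure μ] {Z : Set X}
    (hZ : IsClosed Z) {a : ℝ} (h : μ.real Z < a) :
    ∃ f : C(X, ℝ), (∀ x, 0 ≤ f x) ∧ (∀ x ∈ Z, 1 ≤ f x) ∧ ∫ x, f x ∂μ < a := by
  have hlim := tendsto_integral_thickenedIndicator_of_isClosed μ hZ
    (δs := fun n : ℕ => 1 / ((n : ℝ) + 1)) (fun n => by positivity)
    tendsto_one_div_add_atTop_nhds_zero_nat
  obtain ⟨n, hn⟩ := (hlim.eventually (gt_mem_nhds h)).exists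
  refine ⟨⟨fun x => (thickenedIndicator (δ := 1 / ((n : ℝ) + 1)) (by positivity) Z x : ℝ),
    by fun_prop⟩, fun x => NNReal.coe_nonneg _, fun x hx => ?_, hn⟩
  have := thickenedIndicator_one (δ := 1 / ((n : ℝ) + 1)) (by positivity) Z hx
  simp only [ContinuousMap.coe_mk, this, NNReal.coe_one, le_refl]

theorem measureReal_le_integral (μ : Measure X) [IsProbabilityMeasure μ] {Z : Set X}
    (hZ : IsClosed Z) (f : C(X, ℝ)) (h0 : ∀ x, 0 ≤ f x) (h1 : ∀ x ∈ Z, 1 ≤ f x) :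
    μ.real Z ≤ ∫ x, f x ∂μ := by
  rw [← integral_indicator_one hZ.measurableSet]
  refine integral_mono ((integrable_const _).indicator hZ.measurableSet)
    (integrable_continuousMap μ f) fun x => ?_
  by_cases hx : x ∈ Z
  · simpa [hx] using h1 x hx
  · simpa [hx] using h0 x

/-- Upper semicontinuity: a continuous majorant of the indicator of `Z` with integral below `a`
keeps that property for nearby measures. -/
theorem isOpen_setOf_measureReal_lt {Z : Set X} (hZ : IsClosed Z) (a : ℝ) :
    IsOpen {μ : ProbabilityMeasure X | (μ : Measure X).real Z < a} := by
  rw [isOpen_iff_mem_nhds]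
  intro μ hμ
  obtain ⟨f, h0, h1, hf⟩ := exists_continuous_indicator_le (μ : Measure X) hZ hμ
  refine Filter.mem_of_superset ((isOpen_lt
    (ProbabilityMeasure.continuous_integral_continuousMap f) continuous_const).mem_nhds hf) ?_
  exact fun ν hν => (measureReal_le_integral (ν : Measure X) hZ f h0 h1).trans_lt hν

/-- A strict upper bound for the measure of a closed set on a compact set of extreme invariant
measures gives an upper bound for all invariant measures. -/
theorem measureReal_le_of_forall_extreme (hE : IsCompact (extremeInvariantMeasures G X))
    (hne : (extremeInvariantMeasures G X).Nonempty) {Z : Set X} (hZ : IsClosed Z) {a : ℝ}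
    (h : ∀ ν ∈ extremeInvariantMeasures G X, (ν : Measure X).real Z < a)
    {μ : ProbabilityMeasure X} (hμ : μ ∈ invariantMeasures G X) : (μ : Measure X).real Z ≤ a := by
  have key : ∀ ν ∈ extremeInvariantMeasures G X, ∃ f : C(X, ℝ), (∀ x, 0 ≤ f x) ∧
      (∀ x ∈ Z, 1 ≤ f x) ∧ ∫ x, f x ∂(ν : Measure X) < a := fun ν hν =>
    exists_continuous_indicator_le _ hZ (h ν hν)
  choose! f hf0 hf1 hfa using key
  obtain ⟨t, htE, ht⟩ := hE.elim_nhds_subcover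
    (fun ν => {ν' : ProbabilityMeasure X | ∫ x, f ν x ∂(ν' : Measure X) < a}) fun ν hν =>
    (isOpen_lt (ProbabilityMeasure.continuous_integral_continuousMap (f ν))
      continuous_const).mem_nhds (hfa ν hν)
  have htne : t.Nonempty := by
    obtain ⟨ν, hν⟩ := hne
    obtain ⟨i, hi, -⟩ := mem_iUnion₂.1 (ht hν)
    exact ⟨i, hi⟩
  -- The minimum of the finitely many majorants still dominates the indicator of `Z`, and each
  -- extreme measure gives it integral below `a`.
  refine (measureReal_le_integral (μ : Measure X) hZ (t.inf' htne f) (fun x => ?_)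
    fun x hx => ?_).trans (integral_le_of_forall_extreme _ (fun ν hν => ?_) hμ)
  · rw [ContinuousMap.inf'_apply]
    exact Finset.le_inf' _ _ fun i hi => hf0 i (htE i hi) x
  · rw [ContinuousMap.inf'_apply]
    exact Finset.le_inf' _ _ fun i hi => hf1 i (htE i hi) x hx
  · obtain ⟨i, hi, hνi⟩ := mem_iUnion₂.1 (ht hν)
    refine le_trans (integral_mono (integrable_continuousMap _ _) (integrable_continuousMap _ (f i))
      fun x => ?_) (le_of_lt hνi)
    change (t.inf' htne f) x ≤ f i x
    rw [ContinuousMap.inf'_apply]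
    exact Finset.inf'_le _ hi

end KreinMilman

/-! ### Coloured covers from covering dimension. -/

section ColoredCover

/-- The bounds are upward closed in `k`, so if `m` failed the infimum would be at least `m + 1`. The
empty space is excluded by its dimension `⊥`. -/
theorem hasCoveringDimLE_of_coveringDim_eq {Y : Type*} [TopologicalSpace Y] {m : ℕ}
    (h : coveringDim Y = m) : Nonempty Y ∧ HasCoveringDimLE Y m := by
  unfold coveringDim at h
  split_ifs at h with hY
  · exact absurd h (by simp)
  refine ⟨not_isEmpty_iff.1 hY, ?_⟩
  by_contra hm
  have h1 : (((m + 1 : ℕ) : ℕ∞) : WithBot ℕ∞) ≤ m := by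
    rw [← h]
    refine le_iInf₂ fun k hk => ?_
    rcases Nat.lt_or_ge m k with hmk | hmk
    · exact_mod_cast hmk
    · refine absurd (fun 𝒰 hf ho hc => ?_) hm
      obtain ⟨𝒱, h1, h2, h3, h4, h5⟩ := hk 𝒰 hf ho hc
      exact ⟨𝒱, h1, h2, h3, h4, fun y => (h5 y).trans (by omega)⟩
  have h2 : m + 1 ≤ m := by exact_mod_cast h1
  omega

/-- In a compact Hausdorff space of covering dimension at most `m`, every open cover is refined by
a finite closed cover which is coloured by `m + 1` colours so that distinct members of the same
colour are disjoint. -/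
theorem exists_colored_closed_cover {Y : Type*} [TopologicalSpace Y] [CompactSpace Y] [T2Space Y]
    {m : ℕ} (hdim : HasCoveringDimLE Y m) {ι : Type*} (O : ι → Set Y) (hO : ∀ i, IsOpen (O i))
    (hcov : ⋃ i, O i = univ) :
    ∃ (N : ℕ) (a : Fin N → ι) (c : Fin N → Fin (m + 1)) (C : Fin N → Set Y),
      (∀ j, IsClosed (C j)) ∧ (∀ j, C j ⊆ O (a j)) ∧ ⋃ j, C j = univ ∧
      ∀ i j, i ≠ j → c i = c j → Disjoint (C i) (C j) := by
  classical
  obtain ⟨t, ht⟩ := isCompact_univ.elim_finite_subcover O hO hcov.ge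
  obtain ⟨𝒱, hVfin, hVo, hVcov, hVref, hVord⟩ := hdim (O '' t) (t.finite_toSet.image O)
    (by rintro _ ⟨i, -, rfl⟩; exact hO i)
    (by rw [sUnion_image]; exact univ_subset_iff.1 ht)
  have := hVfin.fintype
  obtain ⟨A, hAcov, hAcl, hAsub⟩ := exists_iUnion_eq_closed_subset (u := fun V : 𝒱 => (V : Set Y))
    (fun V => hVo V V.2) (fun x => toFinite _) (by rw [← sUnion_eq_iUnion, hVcov])
  have hφ : ∀ V : 𝒱, ∃ φ : C(Y, ℝ), (∀ x ∉ (V : Set Y), φ x = 0) ∧ (∀ x ∈ A V, φ x = 1) ∧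
      ∀ x, φ x ≤ 1 := by
    intro V
    obtain ⟨φ, h0, h1, h2⟩ := exists_continuous_zero_one_of_isClosed (hVo V V.2).isClosed_compl
      (hAcl V) (disjoint_compl_left_iff_subset.2 (hAsub V))
    exact ⟨φ, fun x hx => h0 hx, fun x hx => h1 hx, fun x => (h2 x).2⟩
  choose φ hφ0 hφ1 hφle using hφ
  let J : Type _ := {T : Finset 𝒱 // T.Nonempty ∧ T.card ≤ m + 1}
  -- `W T` is where the functions indexed by `T` are positive and strictly dominate all others. For
  -- distinct `T`, `T'` of equal size, some `V ∈ T \ T'` and `U ∈ T' \ T` would each have to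
  -- dominate the other, so `W T` and `W T'` are disjoint. The colour is `T.card - 1`.
  let W : J → Set Y := fun T =>
    (⋂ V ∈ T.1, {x | 0 < φ V x}) ∩ ⋂ V ∈ T.1, ⋂ V' ∈ (T.1)ᶜ, {x | φ V' x < φ V x}
  have hWo : ∀ T, IsOpen (W T) := fun T =>
    (isOpen_biInter_finset fun V _ => isOpen_lt continuous_const (φ V).continuous).inter
      (isOpen_biInter_finset fun V _ => isOpen_biInter_finset fun V' _ =>
        isOpen_lt (φ V').continuous (φ V).continuous)
  have hWcov : ⋃ T, W T = univ := by
    refine eq_univ_of_forall fun x => ?_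
    have hx : x ∈ ⋃ V, A V := hAcov ▸ mem_univ x
    obtain ⟨V₀, hV₀⟩ := mem_iUnion.1 hx
    -- The functions attaining their maximal value 1 at `x`; the order of the cover bounds their
    -- number by `m + 1`.
    set T : Finset 𝒱 := Finset.univ.filter fun V => φ V x = 1 with hT
    have hTmem : ∀ V, V ∈ T ↔ φ V x = 1 := fun V => by simp [hT]
    have hTc : T.card ≤ m + 1 := by
      refine le_trans ?_ (hVord x)
      rw [← Set.ncard_coe_finset]
      refine Set.ncard_le_ncard_of_injOn (fun V : 𝒱 => (V : Set Y)) (fun V hV => ⟨V.2, ?_⟩)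
        Subtype.val_injective.injOn (hVfin.subset fun V hV => hV.1)
      by_contra hxV
      have h1 := (hTmem V).1 hV
      rw [hφ0 V x hxV] at h1
      exact zero_ne_one h1
    refine mem_iUnion.2 ⟨⟨T, ⟨V₀, (hTmem V₀).2 (hφ1 V₀ x hV₀)⟩, hTc⟩, ?_, ?_⟩
    · refine mem_iInter₂.2 fun V hV => ?_
      change 0 < φ V x
      rw [(hTmem V).1 hV]; exact one_pos
    · refine mem_iInter₂.2 fun V hV => mem_iInter₂.2 fun V' hV' => ?_
      change φ V' x < φ V x
      rw [(hTmem V).1 hV]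
      exact lt_of_le_of_ne (hφle V' x) fun h => Finset.mem_compl.1 hV' ((hTmem V').2 h)
  obtain ⟨C, hCcov, hCcl, hCsub⟩ := exists_iUnion_eq_closed_subset hWo
    (fun x => toFinite _) hWcov
  have hWdisj : ∀ T T' : J, T ≠ T' → T.1.card = T'.1.card → Disjoint (W T) (W T') := by
    intro T T' hne hcard
    rw [Set.disjoint_left]
    intro x hx hx'
    have h1 : ¬ T.1 ⊆ T'.1 := fun h =>
      hne (Subtype.ext (Finset.eq_of_subset_of_card_le h hcard.ge))
    have h2 : ¬ T'.1 ⊆ T.1 := fun h =>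
      hne (Subtype.ext (Finset.eq_of_subset_of_card_le h hcard.le).symm)
    obtain ⟨V, hV, hV'⟩ := Finset.not_subset.1 h1
    obtain ⟨U, hU, hU'⟩ := Finset.not_subset.1 h2
    have e1 : φ U x < φ V x :=
      mem_iInter₂.1 (mem_iInter₂.1 hx.2 V hV) U (Finset.mem_compl.2 hU')
    have e2 : φ V x < φ U x :=
      mem_iInter₂.1 (mem_iInter₂.1 hx'.2 U hU) V (Finset.mem_compl.2 hV')
    exact lt_asymm e1 e2
  have hWO : ∀ T : J, ∃ i, W T ⊆ O i := by
    intro T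
    obtain ⟨V, hV⟩ := T.2.1
    obtain ⟨_, ⟨i, -, rfl⟩, hVi⟩ := hVref V V.2
    refine ⟨i, fun x hx => hVi ?_⟩
    by_contra hxV
    have h1 : 0 < φ V x := mem_iInter₂.1 hx.1 V hV
    rw [hφ0 V x hxV] at h1
    exact lt_irrefl _ h1
  choose a ha using hWO
  obtain ⟨N, ⟨e⟩⟩ := Finite.exists_equiv_fin J
  refine ⟨N, fun j => a (e.symm j), fun j => ⟨(e.symm j).1.card - 1, ?_⟩, fun j => C (e.symm j),
    fun j => hCcl _, fun j => (hCsub _).trans (ha _), ?_, fun i j hij hc => ?_⟩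
  · have := (e.symm j).2.2
    omega
  · rw [e.symm.surjective.iUnion_comp C, hCcov]
  · refine (hWdisj _ _ (fun h => hij (e.symm.injective h)) ?_).mono (hCsub _) (hCsub _)
    have h1 := Finset.card_pos.2 (e.symm i).2.1
    have h2 := Finset.card_pos.2 (e.symm j).2.1
    have h3 := Fin.mk.inj hc
    omega

end ColoredCover

/-! ### Separating ergodic measures by open subsets of the space. -/

section Separation

variable {G : Type*} [Group G] {X : Type*} [MetricSpace X] [CompactSpace X] [MeasurableSpace X]
  [BorelSpace X] [MulAction G X] [ContinuousConstSMul G X]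

/-- A continuous function taking the value `j` on the `j`-th of finitely many disjoint closed
sets. -/
theorem exists_continuous_eq_index {Y : Type*} [TopologicalSpace Y] [NormalSpace Y] {N : ℕ}
    (C : Fin N → Set Y) (hC : ∀ j, IsClosed (C j)) (hd : ∀ i j, i ≠ j → Disjoint (C i) (C j)) :
    ∃ h : C(Y, ℝ), ∀ j, ∀ y ∈ C j, h y = (j : ℕ) := by
  have hu : ∀ j, ∃ u : C(Y, ℝ), (∀ y ∈ C j, u y = 1) ∧ ∀ i, i ≠ j → ∀ y ∈ C i, u y = 0 := by
    intro j
    obtain ⟨u, h0, h1, -⟩ := exists_continuous_zero_one_of_isClosed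
      (s := ⋃ i : {i // i ≠ j}, C i) (isClosed_iUnion_of_finite fun i => hC i) (hC j)
      (disjoint_iUnion_left.2 fun i => hd i j i.2)
    exact ⟨u, fun y hy => h1 hy, fun i hi y hy => h0 (mem_iUnion.2 ⟨⟨i, hi⟩, hy⟩)⟩
  choose u hu1 hu0 using hu
  refine ⟨∑ i : Fin N, ((i : ℕ) : ℝ) • u i, fun j y hy => ?_⟩
  rw [ContinuousMap.sum_apply, Finset.sum_eq_single j]
  · simp [hu1 j y hy]
  · intro i _ hij
    simp [hu0 i j hij.symm y hy]
  · simp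

/-- Disjoint closed sets of ergodic measures are concentrated on disjoint open subsets of `X`. -/
theorem exists_separating_open_sets (hG : IsAmenable G)
    (hE : IsCompact (extremeInvariantMeasures G X)) {N : ℕ}
    (C : Fin N → Set (extremeInvariantMeasures G X)) (hC : ∀ j, IsClosed (C j))
    (hd : ∀ i j, i ≠ j → Disjoint (C i) (C j)) {η : ℝ} (hη : 0 < η) :
    ∃ D : Fin N → Set X, (∀ j, IsOpen (D j)) ∧
      (∀ i j, i ≠ j → Disjoint (closure (D i)) (closure (D j))) ∧
      ∀ j, ∀ ν ∈ C j, ((ν : ProbabilityMeasure X) : Measure X).real (D j)ᶜ ≤ η := by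
  have : CompactSpace (extremeInvariantMeasures G X) := isCompact_iff_compactSpace.1 hE
  obtain ⟨h, hh⟩ := exists_continuous_eq_index C hC hd
  -- For `ν ∈ C j` the integral of `f` is within `1/6` of `j`. Where the average is at least `1/3`
  -- from `j` it deviates from the integral by at least `1/6`, so Chebyshev with variance below `η /
  -- 36` bounds that set by `η`. Distinct indices have disjoint closures because `2/3 < 1`.
  obtain ⟨f, hf⟩ := (dense_range_integralMap hG hE).exists_dist_lt h (show (0 : ℝ) < 1 / 6 by norm_num)
  obtain ⟨F, hF, hFf⟩ := exists_orbitAverage_uniform hG hE f (show 0 < η / 36 by positivity)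
  have hcont : ∀ j : Fin N, Continuous fun x => |orbitAverage F f x - (j : ℕ)| := fun j => by
    fun_prop
  refine ⟨fun j => {x | |orbitAverage F f x - (j : ℕ)| < 1 / 3},
    fun j => isOpen_lt (hcont j) continuous_const, fun i j hij => ?_, fun j ν hν => ?_⟩
  · have hcl : ∀ j : Fin N, closure {x | |orbitAverage F f x - (j : ℕ)| < 1 / 3} ⊆
        {x | |orbitAverage F f x - (j : ℕ)| ≤ 1 / 3} := fun j =>
      closure_minimal (fun x hx => (show |orbitAverage F f x - (j : ℕ)| ≤ 1 / 3 from le_of_lt hx)) (isClosed_le (hcont j) continuous_const)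
    refine Disjoint.mono (hcl i) (hcl j) (Set.disjoint_left.2 fun x hx hx' => ?_)
    have h1 := abs_le.1 (show |orbitAverage F f x - (i : ℕ)| ≤ 1 / 3 from hx)
    have h2 := abs_le.1 (show |orbitAverage F f x - (j : ℕ)| ≤ 1 / 3 from hx')
    have h3 : (i : ℕ) ≠ (j : ℕ) := fun h => hij (Fin.ext h)
    rcases Nat.lt_or_gt_of_ne h3 with h4 | h4
    · have h5 : ((i : ℕ) : ℝ) + 1 ≤ (j : ℕ) := by exact_mod_cast h4
      linarith
    · have h5 : ((j : ℕ) : ℝ) + 1 ≤ (i : ℕ) := by exact_mod_cast h4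
      linarith
  · set m : Measure X := ((ν : ProbabilityMeasure X) : Measure X) with hm
    have hνf : |((j : ℕ) : ℝ) - ∫ x, f x ∂m| < 1 / 6 := by
      have h1 := (ContinuousMap.dist_apply_le_dist (f := h) (g := integralMap _ f) ν).trans_lt hf
      rwa [hh j ν hν, Real.dist_eq] at h1
    have hmeas : MeasurableSet {x | |orbitAverage F f x - (j : ℕ)| < 1 / 3}ᶜ :=
      (isOpen_lt (hcont j) continuous_const).measurableSet.compl
    have hint : Integrable (fun x => (orbitAverage F f x - ∫ y, f y ∂m) ^ 2) m :=
      integrable_continuousMap _ ((orbitAverage F f - ContinuousMap.const X (∫ y, f y ∂m)) ^ 2)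
    have h1 : 1 / 36 * m.real {x | |orbitAverage F f x - (j : ℕ)| < 1 / 3}ᶜ ≤
        ∫ x, (orbitAverage F f x - ∫ y, f y ∂m) ^ 2 ∂m := by
      rw [mul_comm, ← smul_eq_mul, ← integral_indicator_const _ hmeas]
      refine integral_mono ((integrable_const _).indicator hmeas) hint fun x => ?_
      by_cases hx : x ∈ {x | |orbitAverage F f x - (j : ℕ)| < 1 / 3}ᶜ
      · rw [indicator_of_mem hx]
        have h2 : 1 / 3 ≤ |orbitAverage F f x - (j : ℕ)| := not_lt.1 hx
        have h3 := abs_sub_le (orbitAverage F f x) (∫ y, f y ∂m) (j : ℕ)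
        rw [abs_sub_comm (∫ y, f y ∂m)] at h3
        have h4 : 1 / 6 ≤ |orbitAverage F f x - ∫ y, f y ∂m| := by linarith
        change 1 / 36 ≤ (orbitAverage F f x - ∫ y, f y ∂m) ^ 2
        rw [← sq_abs]
        nlinarith
      · rw [indicator_of_notMem hx]
        exact sq_nonneg _
    have h2 := hFf ν ν.2
    linarith

/-- The coloured version of `exists_separating_open_sets`. -/
theorem exists_colored_separating_open_sets (hG : IsAmenable G)
    (hE : IsCompact (extremeInvariantMeasures G X)) {N m : ℕ} (c : Fin N → Fin (m + 1))
    (C : Fin N → Set (extremeInvariantMeasures G X)) (hC : ∀ j, IsClosed (C j))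
    (hd : ∀ i j, i ≠ j → c i = c j → Disjoint (C i) (C j)) {η : ℝ} (hη : 0 < η) :
    ∃ D : Fin N → Set X, (∀ j, IsOpen (D j)) ∧
      (∀ i j, i ≠ j → c i = c j → Disjoint (closure (D i)) (closure (D j))) ∧
      ∀ j, ∀ ν ∈ C j, ((ν : ProbabilityMeasure X) : Measure X).real (D j)ᶜ ≤ η := by
  have key : ∀ k : Fin (m + 1), ∃ D : Fin N → Set X, (∀ j, IsOpen (D j)) ∧
      (∀ i j, i ≠ j → Disjoint (closure (D i)) (closure (D j))) ∧
      ∀ j, ∀ ν ∈ {ν | c j = k ∧ ν ∈ C j},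
        ((ν : ProbabilityMeasure X) : Measure X).real (D j)ᶜ ≤ η := by
    intro k
    -- One colour at a time, with the sets of other colours replaced by `∅`.
    refine exists_separating_open_sets hG hE (fun j => {ν | c j = k ∧ ν ∈ C j}) (fun j => ?_)
      (fun i j hij => ?_) hη
    · by_cases h : c j = k
      · simpa [h] using! hC j
      · simp [h]
    · rw [Set.disjoint_left]
      rintro ν ⟨h1, h2⟩ ⟨h3, h4⟩
      exact Set.disjoint_left.1 (hd i j hij (h1.trans h3.symm)) h2 h4
  choose D hDo hDd hDν using key
  refine ⟨fun j => D (c j) j, fun j => hDo _ j, fun i j hij hc => ?_,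
    fun j ν hν => hDν (c j) j ν ⟨rfl, hν⟩⟩
  simp only [hc]
  exact hDd (c j) i j hij

end Separation

/-! ### Coloured castles and almost finiteness. -/

section Main

variable {G : Type*} [Group G] {X : Type*} [MetricSpace X] [CompactSpace X] [MeasurableSpace X]
  [BorelSpace X] [MulAction G X] [ContinuousConstSMul G X]

theorem coe_smul_eq_biUnion (S : Finset G) (V : Set X) : (S : Set G) • V = ⋃ t ∈ S, t • V := by
  rw [← Set.iUnion_smul_set]; simp

/-- If the levels of a castle are cut down to an open set `D` of almost full measure, the castle
still has almost full measure. -/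
theorem measureReal_compl_restrict_le {ι : Type*} [Fintype ι] (μ : Measure X)
    [IsProbabilityMeasure μ] [SMulInvariantMeasure G X μ] (S : ι → Finset G) (V : ι → Set X)
    (D : Set X) {η : ℝ} (hD : μ.real Dᶜ ≤ η) :
    μ.real (⋃ i, ⋃ s ∈ S i, s • (V i ∩ ⋂ t ∈ S i, (fun x : X => t • x) ⁻¹' D))ᶜ ≤
      μ.real (⋃ i, ⋃ s ∈ S i, s • V i)ᶜ + (∑ i, ((S i).card : ℝ) ^ 2) * η := by
  -- A base point is lost if one of its `|S i|` translates leaves `D`, and then all `|S i|` levels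
  -- above it are lost; hence the square.
  have hsub : (⋃ i, ⋃ s ∈ S i, s • (V i ∩ ⋂ t ∈ S i, (fun x : X => t • x) ⁻¹' D))ᶜ ⊆
      (⋃ i, ⋃ s ∈ S i, s • V i)ᶜ ∪ ⋃ i, ⋃ s ∈ S i, s • ⋃ t ∈ S i, t⁻¹ • Dᶜ := by
    intro x hx
    by_cases hxV : x ∈ ⋃ i, ⋃ s ∈ S i, s • V i
    · simp only [mem_iUnion] at hxV
      obtain ⟨i, s, hs, y, hy, rfl⟩ := hxV
      have hyD : ¬ ∀ t ∈ S i, t • y ∈ D := fun h => hx <|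
        mem_iUnion.2 ⟨i, mem_iUnion₂.2 ⟨s, hs, y, ⟨hy, mem_iInter₂.2 h⟩, rfl⟩⟩
      push Not at hyD
      obtain ⟨t, ht, hty⟩ := hyD
      exact Or.inr (mem_iUnion.2 ⟨i, mem_iUnion₂.2 ⟨s, hs, y,
        mem_iUnion₂.2 ⟨t, ht, mem_inv_smul_set_iff.2 hty⟩, rfl⟩⟩)
    · exact Or.inl hxV
  refine (measureReal_mono hsub).trans ((measureReal_union_le _ _).trans ?_)
  gcongr
  refine (measureReal_iUnion_levels_le μ S _).trans ?_
  rw [Finset.sum_mul]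
  refine Finset.sum_le_sum fun i _ => ?_
  rw [sq, mul_assoc]
  gcongr
  refine (measureReal_biUnion_finset_le _ _).trans ?_
  refine (Finset.sum_le_sum (g := fun _ => η) fun t _ => ?_).trans (by simp)
  rwa [measureReal_def, measure_smul]

/-- A coloured castle retains a definite proportion of its measure if a definite proportion of each
shape is retained. -/
theorem measureReal_le_of_colored {ι : Type*} [Fintype ι] (μ : Measure X)
    [IsProbabilityMeasure μ] [SMulInvariantMeasure G X μ] {d : ℕ} (c : ι → Fin d)
    {S S' : ι → Finset G} {V : ι → Set X} (hV : ∀ i, MeasurableSet (V i))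
    (hS' : ∀ i, S' i ⊆ S i)
    (hd : ∀ i j, c i = c j → ∀ s ∈ S i, ∀ t ∈ S j, (i, s) ≠ (j, t) →
      Disjoint (s • V i) (t • V j)) {r : ℝ} (hr : 0 ≤ r)
    (hcard : ∀ i, ((S i).card : ℝ) ≤ r * (S' i).card) :
    μ.real (⋃ i, ⋃ s ∈ S i, s • V i) ≤ r * (d * μ.real (⋃ i, ⋃ s ∈ S' i, s • V i)) := by
  classical
  -- Levels are disjoint only within a colour, so measures add up one colour at a time, at the cost
  -- of the factor `d`.
  have hcol : ∀ k : Fin d, ∑ i, (if c i = k then ((S' i).card : ℝ) * μ.real (V i) else 0) ≤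
      μ.real (⋃ i, ⋃ s ∈ S' i, s • V i) := by
    intro k
    have h1 := measureReal_iUnion_levels μ (S := fun i => if c i = k then S' i else ∅) hV
      (by
        intro i j s hs t ht hne
        split_ifs at hs with hi
        · split_ifs at ht with hj
          · exact hd i j (hi.trans hj.symm) s (hS' i hs) t (hS' j ht) hne
          · simp at ht
        · simp at hs)
    have h2 : ∑ i, (if c i = k then ((S' i).card : ℝ) * μ.real (V i) else 0) =
        ∑ i, (((if c i = k then S' i else ∅ : Finset G)).card : ℝ) * μ.real (V i) :=
      Finset.sum_congr rfl fun i _ => by split_ifs <;> simp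
    rw [h2, ← h1]
    refine measureReal_mono (iUnion_mono fun i => ?_)
    split_ifs
    · exact le_rfl
    · simp
  calc _ ≤ _ := measureReal_iUnion_levels_le μ S V
    _ ≤ ∑ i, r * (((S' i).card : ℝ) * μ.real (V i)) := by
        refine Finset.sum_le_sum fun i _ => ?_
        rw [← mul_assoc]
        exact mul_le_mul_of_nonneg_right (hcard i) measureReal_nonneg
    _ = r * ∑ k : Fin d, ∑ i, (if c i = k then ((S' i).card : ℝ) * μ.real (V i) else 0) := by
        rw [← Finset.mul_sum, Finset.sum_comm]
        simp
    _ ≤ r * ∑ _k : Fin d, μ.real (⋃ i, ⋃ s ∈ S' i, s • V i) := by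
        gcongr with k; exact hcol k
    _ = _ := by simp

/-- If the extreme invariant measures form a compact set of covering dimension at most `m`, there
is an open castle which is coloured by `m + 1` colours and has almost full measure with respect to
every invariant measure. -/
theorem exists_colored_castle (hG : IsAmenable G) (hfree : IsFreeAction G X) {m : ℕ}
    (hE : IsCompact (extremeInvariantMeasures G X)) (hne : (extremeInvariantMeasures G X).Nonempty)
    (hdim : HasCoveringDimLE (extremeInvariantMeasures G X) m) (K : Finset G) {δ ρ ε : ℝ}
    (hδ : 0 < δ) (hδ1 : δ ≤ 1) (hρ : 0 < ρ) (hε : 0 < ε) :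
    ∃ (N : ℕ) (S : Fin N → Finset G) (V : Fin N → Set X) (c : Fin N → Fin (m + 1)),
      (∀ i, IsOpen (V i)) ∧ (∀ i, IsFolnerInvariant K δ (S i)) ∧
      (∀ i, ∀ s ∈ S i, Metric.diam (s • closure (V i)) < ρ) ∧
      (∀ i j, c i = c j → ∀ s ∈ S i, ∀ t ∈ S j, (i, s) ≠ (j, t) →
        Disjoint (s • closure (V i)) (t • closure (V j))) ∧
      ∀ μ ∈ invariantMeasures G X, (μ : Measure X).real (⋃ i, ⋃ s ∈ S i, s • V i)ᶜ ≤ ε := by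
  classical
  have : CompactSpace (extremeInvariantMeasures G X) := isCompact_iff_compactSpace.1 hE
  have hQ : ∀ ν : extremeInvariantMeasures G X, ∃ Q : OpenCastle G X K δ ρ,
      ((ν : ProbabilityMeasure X) : Measure X).real Q.carrierᶜ < ε / 2 := by
    intro ν
    have := smulInvariant_of_mem_extreme ν.2
    exact exists_openCastle hG hfree _ K hδ hδ1 hρ (half_pos hε)
  choose Q hQ using hQ
  obtain ⟨N, a, c, C, hCcl, hCO, hCcov, hCd⟩ := exists_colored_closed_cover hdim
    (fun ν => {ν' : extremeInvariantMeasures G X |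
      ((ν' : ProbabilityMeasure X) : Measure X).real (Q ν).carrierᶜ < ε / 2})
    (fun ν => (isOpen_setOf_measureReal_lt (Q ν).isOpen_carrier.isClosed_compl
      (ε / 2)).preimage continuous_subtype_val)
    (eq_univ_of_forall fun ν => mem_iUnion.2 ⟨ν, hQ ν⟩)
  obtain ⟨B, hB⟩ : ∃ B : ℝ, B = ∑ j, ∑ i, (((Q (a j)).S i).card : ℝ) ^ 2 := ⟨_, rfl⟩
  have hB0 : 0 ≤ B := hB ▸ Finset.sum_nonneg fun j _ => Finset.sum_nonneg fun i _ => sq_nonneg _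
  have hBj : ∀ j, ∑ i, (((Q (a j)).S i).card : ℝ) ^ 2 ≤ B := fun j => hB ▸
    Finset.single_le_sum (f := fun j => ∑ i, (((Q (a j)).S i).card : ℝ) ^ 2)
      (fun j _ => Finset.sum_nonneg fun i _ => sq_nonneg _) (Finset.mem_univ j)
  -- `B` bounds the loss factor for every castle used, so cutting down costs at most `ε / 2`.
  obtain ⟨η, hη0, hη⟩ : ∃ η : ℝ, 0 < η ∧ (B + 1) * η = ε / 2 :=
    ⟨ε / 2 / (B + 1), by positivity, mul_div_cancel₀ _ (by positivity)⟩
  obtain ⟨D, hDo, hDd, hDν⟩ := exists_colored_separating_open_sets hG hE c C hCcl hCd hη0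
  let S : (Σ j, (Q (a j)).ι) → Finset G := fun p => (Q (a p.1)).S p.2
  let V : (Σ j, (Q (a j)).ι) → Set X := fun p =>
    (Q (a p.1)).V p.2 ∩ ⋂ t ∈ S p, (fun x : X => t • x) ⁻¹' D p.1
  have hVo : ∀ p, IsOpen (V p) := fun p => ((Q (a p.1)).isOpen p.2).inter
    (isOpen_biInter_finset fun t _ => (hDo p.1).preimage (continuous_const_smul t))
  have hVQ : ∀ p, closure (V p) ⊆ closure ((Q (a p.1)).V p.2) := fun p =>
    closure_mono inter_subset_left
  have hVD : ∀ p, ∀ s ∈ S p, s • closure (V p) ⊆ closure (D p.1) := by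
    intro p s hs
    rw [← closure_smul]
    refine closure_mono ?_
    rintro _ ⟨x, hx, rfl⟩
    exact mem_iInter₂.1 hx.2 s hs
  have hcov : ∀ ν ∈ extremeInvariantMeasures G X,
      (ν : Measure X).real (⋃ p, ⋃ s ∈ S p, s • V p)ᶜ < ε := by
    intro ν hν
    have := smulInvariant_of_mem_extreme hν
    obtain ⟨j, hj⟩ := mem_iUnion.1 (hCcov ▸ mem_univ (⟨ν, hν⟩ : extremeInvariantMeasures G X))
    have h1 := measureReal_compl_restrict_le (ν : Measure X) (Q (a j)).S (Q (a j)).V (D j)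
      (hDν j _ hj)
    have h2 : (ν : Measure X).real (⋃ i, ⋃ s ∈ (Q (a j)).S i, s • (Q (a j)).V i)ᶜ < ε / 2 :=
      hCO j hj
    have h3 : (ν : Measure X).real (⋃ p, ⋃ s ∈ S p, s • V p)ᶜ ≤
        (ν : Measure X).real (⋃ i, ⋃ s ∈ (Q (a j)).S i,
          s • ((Q (a j)).V i ∩ ⋂ t ∈ (Q (a j)).S i, (fun x : X => t • x) ⁻¹' D j))ᶜ := by
      refine measureReal_mono (compl_subset_compl.2 (iUnion_subset fun i => ?_))
      exact subset_iUnion (fun p : (Σ j, (Q (a j)).ι) => ⋃ s ∈ S p, s • V p) ⟨j, i⟩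
    have h4 : (∑ i, (((Q (a j)).S i).card : ℝ) ^ 2) * η ≤ B * η := by gcongr; exact hBj j
    linarith
  -- Within one castle levels are already disjoint; levels of different castles of the same colour
  -- lie in disjoint closures of sets `D j`.
  have hdisj : ∀ p q : (Σ j, (Q (a j)).ι), c p.1 = c q.1 → ∀ s ∈ S p, ∀ t ∈ S q,
      (p, s) ≠ (q, t) → Disjoint (s • closure (V p)) (t • closure (V q)) := by
    rintro ⟨j, i⟩ ⟨j', i'⟩ hc s hs t ht hne
    by_cases hjj : j = j'
    · subst hjj
      refine ((Q (a j)).disjoint i i' s hs t ht ?_).mono (Set.smul_set_mono (hVQ ⟨j, i⟩))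
        (Set.smul_set_mono (hVQ ⟨j, i'⟩))
      intro h
      obtain ⟨rfl, rfl⟩ := Prod.mk.inj h
      exact hne rfl
    · exact (hDd j j' hjj hc).mono (hVD _ s hs) (hVD _ t ht)
  let e := Fintype.equivFin (Σ j, (Q (a j)).ι)
  refine ⟨_, fun k => S (e.symm k), fun k => V (e.symm k), fun k => c (e.symm k).1,
    fun k => hVo _, fun k => (Q _).invariant _, fun k s hs => ?_, fun k l hc s hs t ht hne => ?_,
    fun μ hμ => ?_⟩
  · exact (Metric.diam_mono (Set.smul_set_mono (hVQ _)) Metric.isBounded_of_compactSpace).trans_lt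
      ((Q _).diam_lt _ s hs)
  · refine hdisj _ _ hc s hs t ht fun h => hne ?_
    obtain ⟨h1, rfl⟩ := Prod.mk.inj h
    rw [e.symm.injective h1]
  · rw [e.symm.surjective.iUnion_comp fun p => ⋃ s ∈ S p, s • V p]
    exact measureReal_le_of_forall_extreme hE hne
      (isOpen_iUnion fun p => isOpen_biUnion fun s _ => (hVo p).smul s).isClosed_compl hcov hμ

theorem isAlmostFinite_of_comparison [Infinite G] (hG : IsAmenable G) (hfree : IsFreeAction G X)
    {m : ℕ} (hE : IsCompact (extremeInvariantMeasures G X))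
    (hne : (extremeInvariantMeasures G X).Nonempty)
    (hdim : HasCoveringDimLE (extremeInvariantMeasures G X) m)
    (hcomp : HasDynamicalComparison G X 0) : IsAlmostFinite G X m := by
  classical
  intro n K δ hn hδ
  have hn' : (0 : ℝ) < n := by exact_mod_cast hn
  -- Invariance under `n` elements forces `|S i| ≥ n`, so `⌊|S i| / n⌋` is positive and at least `|S
  -- i| / (2n)`.
  obtain ⟨K₀, hK₀⟩ := Infinite.exists_subset_card_eq G n
  obtain ⟨ε, hε0, hε⟩ : ∃ ε : ℝ, 0 < ε ∧ ε * (4 * n * (m + 1)) = 1 :=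
    ⟨1 / (4 * n * (m + 1)), by positivity, div_mul_cancel₀ _ (by positivity)⟩
  obtain ⟨N, S, V, c, hVo, hinv, hdiam, hdisj, hcov⟩ := exists_colored_castle hG hfree hE hne hdim
    (K ∪ K₀) (δ := min δ (1 / 2)) (lt_min hδ (by norm_num))
    ((min_le_right _ _).trans (by norm_num)) hδ hε0
  have hcardS : ∀ i, n ≤ (S i).card := fun i => by
    rw [← hK₀]
    exact (Finset.card_le_card Finset.subset_union_right).trans
      ((hinv i).card_le_card ((min_le_right _ _).trans_lt (by norm_num)))
  have hS' : ∀ i, ∃ T ⊆ S i, T.card = (S i).card / n := fun i =>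
    Finset.exists_subset_card_eq (Nat.div_le_self _ _)
  choose S' hS'S hS'c using hS'
  have hcardS' : ∀ i, ((S i).card : ℝ) ≤ 2 * n * (S' i).card := by
    intro i
    have h1 : 1 ≤ (S i).card / n := (Nat.one_le_div_iff hn).2 (hcardS i)
    have h2 : (S i).card < n * ((S i).card / n + 1) := Nat.lt_mul_div_succ _ hn
    have h3 : (S i).card ≤ 2 * n * (S' i).card := by
      rw [hS'c]
      nlinarith
    exact_mod_cast h3
  refine ⟨N, S, V, fun i s hs t ht hst => ?_, hVo, fun i => ?_, hdiam, ⟨c, fun i j hij hc => ?_⟩,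
    S', hS'S, fun i => ?_, ?_⟩
  · exact hdisj i i rfl s hs t ht fun h => hst (Prod.mk.inj h).2
  · exact (hinv i).mono Finset.subset_union_left (min_le_left _ _)
  · simp only [coe_smul_eq_biUnion]
    refine disjoint_iUnion₂_left.2 fun s hs => disjoint_iUnion₂_right.2 fun t ht => ?_
    exact hdisj i j hc s hs t ht fun h => hij (Prod.mk.inj h).1
  · rw [hS'c]
    exact Nat.cast_div_le
  · simp only [coe_smul_eq_biUnion, ← compl_eq_univ_sdiff]
    refine hcomp _ _ (isOpen_iUnion fun i => isOpen_biUnion fun s _ =>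
      (hVo i).smul s).isClosed_compl (isOpen_iUnion fun i => isOpen_biUnion fun s _ =>
      (hVo i).smul s) fun μ hμ => ?_
    have hμ' : SMulInvariantMeasure G X (μ : Measure X) := hμ
    have h1 := hcov μ hμ
    have h2 := measureReal_le_of_colored (μ : Measure X) c (fun i => (hVo i).measurableSet) hS'S
      (fun i j hc s hs t ht hne => (hdisj i j hc s hs t ht hne).mono
        (Set.smul_set_mono subset_closure) (Set.smul_set_mono subset_closure))
      (by positivity) hcardS'
    have h3 : (μ : Measure X).real (⋃ i, ⋃ s ∈ S i, s • V i)ᶜ =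
        1 - (μ : Measure X).real (⋃ i, ⋃ s ∈ S i, s • V i) :=
      probReal_compl_eq_one_sub (MeasurableSet.iUnion fun i => Finset.measurableSet_biUnion _
        fun s _ => ((hVo i).smul s).measurableSet)
    push_cast at h2
    set w := (μ : Measure X).real (⋃ i, ⋃ s ∈ S' i, s • V i) with hw
    have hnm : (1 : ℝ) ≤ n * (m + 1) := by
      have : (1 : ℝ) ≤ n := by exact_mod_cast hn
      nlinarith [(Nat.cast_nonneg m : (0 : ℝ) ≤ m)]
    -- The castle has measure at least `1 - ε` and at most `2n(m + 1) w`. If `w ≤ ε` the latter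
    -- would be at most `1/2`, whereas `ε ≤ 1/4`.
    have h4 : ε < w := by
      by_contra hcon
      push Not at hcon
      have h5 : (n * (m + 1) : ℝ) * w ≤ n * (m + 1) * ε := by gcongr
      nlinarith
    refine (ENNReal.toReal_lt_toReal (measure_ne_top _ _) (measure_ne_top _ _)).1 ?_
    exact h1.trans_lt h4

end Main

end TopDyn

theorem theorem3p4 {G : Type*} [Group G] [Countable G] [Infinite G] (hG : TopDyn.IsAmenable G)
    {X : Type*} [MetricSpace X] [CompactSpace X] [Infinite X]
    [MeasurableSpace X] [BorelSpace X] [MulAction G X] [ContinuousConstSMul G X]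
    [MulAction.IsMinimal G X] (hfree : TopDyn.IsFreeAction G X)
    (m : ℕ)
    (hcompact : IsCompact (TopDyn.extremeInvariantMeasures G X))
    (hdim : TopDyn.coveringDim (TopDyn.extremeInvariantMeasures G X) = m)
    (hcomp : TopDyn.HasDynamicalComparison G X 0) :
    TopDyn.IsAlmostFinite G X m := by
  obtain ⟨hne, hdim'⟩ := TopDyn.hasCoveringDimLE_of_coveringDim_eq hdim
  exact TopDyn.isAlmostFinite_of_comparison hG hfree hcompact
    (nonempty_coe_sort.1 hne) hdim' hcomp
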